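/- **Theorem (restriction rule).** A composition $\alpha=(\alpha_1,\dots,\alpha_\ell)\vDash n$ is a list of positive integers with sum $n$; its diagram has $\alpha_i$ left-justified cells in row $i$ from the top, and $(i,j)$ denotes the cell in row $i$ and column $j$. Let $\le_c$ be the partial order on compositions generated by the covering relations: $(\alpha_1,\dots,\alpha_\ell)$ is covered by $(1,\alpha_1,\dots,\alpha_\ell)$, and by $(\alpha_1,\dots,\alpha_k+1,\dots,\alpha_\ell)$ whenever $\alpha_i\ne\alpha_k$ for all $i<k$. For $\beta\le_c\alpha$ let $\alpha/\!\!/\beta$ be the set of cells of $\alpha$ that are not in $\beta$, where $\beta$ is drawn in the bottom left corner of $\alpha$, and let $N=|\alpha|-|\beta|$. A *skew standard reverse composition tableau* (skew SRCT) of shape $\alpha/\!\!/\beta$ is a bijection $\tau:\alpha/\!\!/\beta\to\{1,\dots,N\}$ such that the entries decrease from left to right in each row; the entries of the first column increase from top to bottom; and, with $\tau=\infty$ on the cells of $\beta$: if $i<j$, $(i,k)\in\alpha$, $(j,k+1)\in\alpha/\!\!/\beta$ and $\tau(i,k)>\tau(j,k+1)$, then $(i,k+1)\in\alpha$ and $\tau(i,k+1)>\tau(j,k+1)$.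 Let $H_N(0)$ be the $\mathbb C$-algebra generated by $T_1,\dots,T_{N-1}$ with relations $T_i^2=T_i$, $T_iT_{i+1}T_i=T_{i+1}T_iT_{i+1}$, and $T_iT_j=T_jT_i$ for $|i-j|\ge2$ (so $H_0(0)=H_1(0)=\mathbb C$). Let $\mathbf S_{\alpha/\!\!/\beta}$ be the $H_N(0)$-module with $\mathbb C$-basis the skew SRCTs of shape $\alpha/\!\!/\beta$ on which $T_i$ acts by $\tau\mapsto\tau$ if $i+1$ lies in a column strictly left of that of $i$; otherwise $\tau\mapsto0$ if $i$ and $i+1$ are in the same column, or if $i+1$ is in the column immediately to the right of that of $i$ and in a strictly lower row; and otherwise $\tau\mapsto s_i(\tau)$, where $s_i(\tau)$ is obtained by exchanging the entries $i$ and $i+1$. Put $\mathbf S_\alpha=\mathbf S_{\alpha/\!\!/\varnothing}$. Let $0\le m\le n$ and $\alpha\vDash n$. Let $H_{m,n-m}(0)$ be the subalgebra of $H_n(0)$ generated by the $T_i$ with $1\le i\le n-1$, $i\neq m$, identified with $H_m(0)\otimes H_{n-m}(0)$ through the isomorphism $T_i\mapsto T_i\otimes1$ for $i<m$ and $T_i\mapsto1\otimes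 T_{i-m}$ for $i>m$. Then there is an isomorphism of $H_m(0)\otimes H_{n-m}(0)$-modules $$\mathbf S_\alpha\big\downarrow^{H_n(0)}_{H_{m,n-m}(0)}\;\cong\;\bigoplus_{\substack{\beta\vDash n-m\\ \beta\le_c\alpha}}\mathbf S_{\alpha/\!\!/\beta}\otimes\mathbf S_\beta .$$ (For $m\ge1$ the condition $\beta\le_c\alpha$ is the same as $\beta<_c\alpha$.) -/

import Mathlib

open scoped TensorProduct DirectSum

namespace ZeroHecke

noncomputable section

/-! ### The 0-Hecke algebra -/

/-- The defining relations of the `0`-Hecke algebra `H_n(0)`. The generators `T_1, …, T_{n-1}` are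
indexed by `Fin (n - 1)`: the index `i` (counted from `0`) stands for `T_{i+1}`. -/
inductive HeckeRel (n : ℕ) :
    FreeAlgebra ℂ (Fin (n - 1)) → FreeAlgebra ℂ (Fin (n - 1)) → Prop
  | sq (i : Fin (n - 1)) :
      HeckeRel n (FreeAlgebra.ι ℂ i * FreeAlgebra.ι ℂ i) (FreeAlgebra.ι ℂ i)
  | braid (i j : Fin (n - 1)) (h : i.val + 1 = j.val) :
      HeckeRel n (FreeAlgebra.ι ℂ i * FreeAlgebra.ι ℂ j * FreeAlgebra.ι ℂ i)
        (FreeAlgebra.ι ℂ j * FreeAlgebra.ι ℂ i * FreeAlgebra.ι ℂ j)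
  | comm (i j : Fin (n - 1)) (h : i.val + 2 ≤ j.val) :
      HeckeRel n (FreeAlgebra.ι ℂ i * FreeAlgebra.ι ℂ j)
        (FreeAlgebra.ι ℂ j * FreeAlgebra.ι ℂ i)

/-- The `0`-Hecke algebra `H_n(0)` over `ℂ`, by generators and relations. -/
def Hecke (n : ℕ) : Type := RingQuot (HeckeRel n)

instance (n : ℕ) : Ring (Hecke n) := inferInstanceAs (Ring (RingQuot (HeckeRel n)))

instance (n : ℕ) : Algebra ℂ (Hecke n) := inferInstanceAs (Algebra ℂ (RingQuot (HeckeRel n)))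

/-- The generator `T_{i+1}` of `H_n(0)`. -/
def T {n : ℕ} (i : Fin (n - 1)) : Hecke n :=
  RingQuot.mkAlgHom ℂ (HeckeRel n) (FreeAlgebra.ι ℂ i)

theorem T_sq {n : ℕ} (i : Fin (n - 1)) : T i * T i = T i := by
  have h := RingQuot.mkAlgHom_rel ℂ (HeckeRel.sq (n := n) i)
  rw [map_mul] at h
  exact h

theorem T_braid {n : ℕ} (i j : Fin (n - 1)) (hij : i.val + 1 = j.val) :
    T i * T j * T i = T j * T i * T j := by
  have h := RingQuot.mkAlgHom_rel ℂ (HeckeRel.braid (n := n) i j hij)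
  simp only [map_mul] at h
  exact h

theorem T_comm {n : ℕ} (i j : Fin (n - 1)) (hij : i.val + 2 ≤ j.val) :
    T i * T j = T j * T i := by
  have h := RingQuot.mkAlgHom_rel ℂ (HeckeRel.comm (n := n) i j hij)
  simp only [map_mul] at h
  exact h

/-- Elements satisfying the relations of `H_n(0)` define an algebra map out of `H_n(0)`. -/
def heckeLift {n : ℕ} {A : Type*} [Ring A] [Algebra ℂ A] (f : Fin (n - 1) → A)
    (hsq : ∀ i, f i * f i = f i)
    (hbraid : ∀ i j, i.val + 1 = j.val → f i * f j * f i = f j * f i * f j)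
    (hcomm : ∀ i j, i.val + 2 ≤ j.val → f i * f j = f j * f i) : Hecke n →ₐ[ℂ] A :=
  RingQuot.liftAlgHom ℂ ⟨FreeAlgebra.lift ℂ f, by
    rintro _ _ (⟨i⟩ | ⟨i, j, h⟩ | ⟨i, j, h⟩)
    · simpa using hsq i
    · simpa using hbraid i j h
    · simpa using hcomm i j h⟩

@[simp] theorem heckeLift_T {n : ℕ} {A : Type*} [Ring A] [Algebra ℂ A] (f : Fin (n - 1) → A)
    (hsq : ∀ i, f i * f i = f i)
    (hbraid : ∀ i j, i.val + 1 = j.val → f i * f j * f i = f j * f i * f j)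
    (hcomm : ∀ i j, i.val + 2 ≤ j.val → f i * f j = f j * f i) (i : Fin (n - 1)) :
    heckeLift f hsq hbraid hcomm (T i) = f i := by
  unfold heckeLift T
  erw [RingQuot.liftAlgHom_mkAlgHom_apply]
  simp

theorem hecke_hom_ext {n : ℕ} {A : Type*} [Ring A] [Algebra ℂ A] {f g : Hecke n →ₐ[ℂ] A}
    (h : ∀ i, f (T i) = g (T i)) : f = g := by
  apply RingQuot.ringQuot_ext'
  apply FreeAlgebra.hom_ext
  funext i
  exact h i

/-- The generators generate `H_n(0)`. -/
theorem adjoin_T (n : ℕ) : Algebra.adjoin ℂ (Set.range (T (n := n))) = ⊤ := by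
  set S := Algebra.adjoin ℂ (Set.range (T (n := n))) with hS
  have hm : ∀ i : Fin (n - 1), T i ∈ S := fun i => Algebra.subset_adjoin ⟨i, rfl⟩
  let g : Hecke n →ₐ[ℂ] S := heckeLift (fun i => ⟨T i, hm i⟩)
    (fun i => Subtype.ext (T_sq i)) (fun i j h => Subtype.ext (T_braid i j h))
    (fun i j h => Subtype.ext (T_comm i j h))
  have hg : S.val.comp g = AlgHom.id ℂ _ := hecke_hom_ext (fun i => by simp [g])
  rw [eq_top_iff]
  intro x _
  have hx := DFunLike.congr_fun hg x
  simp only [AlgHom.comp_apply, AlgHom.id_apply] at hx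
  rw [← hx]
  exact (g x).2

/-! ### The parabolic subalgebra `H_{m,n-m}(0)` -/

/-- `H_{m,n-m}(0)`: the subalgebra of `H_n(0)` generated by all `T_j`, `1 ≤ j ≤ n - 1`, with
`j ≠ m`. -/
def parabolic (n m : ℕ) : Subalgebra ℂ (Hecke n) :=
  Algebra.adjoin ℂ {x | ∃ i : Fin (n - 1), i.val + 1 ≠ m ∧ x = T i}

/-- The index of `T_j ∈ H_n(0)` for `1 ≤ j < m`. -/
def lowIdx {n m : ℕ} (hm : m ≤ n) (i : Fin (m - 1)) : Fin (n - 1) := ⟨i.val, by omega⟩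

/-- The index of `T_{m+j} ∈ H_n(0)` for `1 ≤ j < n - m`. -/
def highIdx {n m : ℕ} (hm : m ≤ n) (i : Fin (n - m - 1)) : Fin (n - 1) :=
  ⟨m + i.val, by omega⟩

/-- The map `H_m(0) → H_n(0)`, `T_j ↦ T_j`. -/
def lowHom {n m : ℕ} (hm : m ≤ n) : Hecke m →ₐ[ℂ] Hecke n :=
  heckeLift (fun i => T (lowIdx hm i)) (fun _ => T_sq _)
    (fun i j h => T_braid _ _ (by simpa [lowIdx] using h))
    (fun i j h => T_comm _ _ (by simpa [lowIdx] using h))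

/-- The map `H_{n-m}(0) → H_n(0)`, `T_j ↦ T_{m+j}`. -/
def highHom {n m : ℕ} (hm : m ≤ n) : Hecke (n - m) →ₐ[ℂ] Hecke n :=
  heckeLift (fun i => T (highIdx hm i)) (fun _ => T_sq _)
    (fun i j h => T_braid _ _ (by simp only [highIdx]; omega))
    (fun i j h => T_comm _ _ (by simp only [highIdx]; omega))

theorem low_high_commute {n m : ℕ} (hm : m ≤ n) (x : Hecke m) (y : Hecke (n - m)) :
    Commute (lowHom hm x) (highHom hm y) := by
  have hx : x ∈ Algebra.adjoin ℂ (Set.range (T (n := m))) := by rw [adjoin_T]; trivial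
  have hy : y ∈ Algebra.adjoin ℂ (Set.range (T (n := n - m))) := by rw [adjoin_T]; trivial
  induction hx using Algebra.adjoin_induction with
  | mem x hx =>
    obtain ⟨i, rfl⟩ := hx
    induction hy using Algebra.adjoin_induction with
    | mem y hy =>
      obtain ⟨j, rfl⟩ := hy
      simp only [lowHom, highHom, heckeLift_T]
      exact T_comm _ _ (by simp only [lowIdx, highIdx]; omega)
    | algebraMap r => rw [AlgHom.commutes]; exact (Algebra.commutes r _).symm
    | add a b _ _ ha hb => rw [map_add]; exact ha.add_right hb
    | mul a b _ _ ha hb => rw [map_mul]; exact ha.mul_right hb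
  | algebraMap r => rw [AlgHom.commutes]; exact Algebra.commutes r _
  | add a b _ _ ha hb => rw [map_add]; exact ha.add_left hb
  | mul a b _ _ ha hb => rw [map_mul]; exact ha.mul_left hb

/-- The map `H_m(0) ⊗ H_{n-m}(0) → H_n(0)`, `T_i ⊗ 1 ↦ T_i`, `1 ⊗ T_j ↦ T_{m+j}`. -/
def tensorHom {n m : ℕ} (hm : m ≤ n) : Hecke m ⊗[ℂ] Hecke (n - m) →ₐ[ℂ] Hecke n :=
  Algebra.TensorProduct.lift (lowHom hm) (highHom hm) (low_high_commute hm)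

theorem lowHom_mem {n m : ℕ} (hm : m ≤ n) (x : Hecke m) : lowHom hm x ∈ parabolic n m := by
  have hx : x ∈ Algebra.adjoin ℂ (Set.range (T (n := m))) := by rw [adjoin_T]; trivial
  induction hx using Algebra.adjoin_induction with
  | mem x hx =>
    obtain ⟨i, rfl⟩ := hx
    simp only [lowHom, heckeLift_T]
    exact Algebra.subset_adjoin ⟨_, by simp only [lowIdx]; omega, rfl⟩
  | algebraMap r => rw [AlgHom.commutes]; exact Subalgebra.algebraMap_mem _ r
  | add a b _ _ ha hb => rw [map_add]; exact add_mem ha hb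
  | mul a b _ _ ha hb => rw [map_mul]; exact mul_mem ha hb

theorem highHom_mem {n m : ℕ} (hm : m ≤ n) (x : Hecke (n - m)) :
    highHom hm x ∈ parabolic n m := by
  have hx : x ∈ Algebra.adjoin ℂ (Set.range (T (n := n - m))) := by rw [adjoin_T]; trivial
  induction hx using Algebra.adjoin_induction with
  | mem x hx =>
    obtain ⟨i, rfl⟩ := hx
    simp only [highHom, heckeLift_T]
    exact Algebra.subset_adjoin ⟨_, by simp only [highIdx]; omega, rfl⟩
  | algebraMap r => rw [AlgHom.commutes]; exact Subalgebra.algebraMap_mem _ r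
  | add a b _ _ ha hb => rw [map_add]; exact add_mem ha hb
  | mul a b _ _ ha hb => rw [map_mul]; exact mul_mem ha hb

theorem tensorHom_mem {n m : ℕ} (hm : m ≤ n) (x : Hecke m ⊗[ℂ] Hecke (n - m)) :
    tensorHom hm x ∈ parabolic n m := by
  induction x using TensorProduct.induction_on with
  | zero => rw [map_zero]; exact zero_mem _
  | tmul a b =>
    simp only [tensorHom, Algebra.TensorProduct.lift_tmul]
    exact mul_mem (lowHom_mem hm a) (highHom_mem hm b)
  | add a b ha hb => rw [map_add]; exact add_mem ha hb

/-- The images of the generators under the algebra map `H_n(0) → H_m(0) ⊗ H_{n-m}(0)` with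
`T_i ↦ T_i ⊗ 1` for `i < m`, `T_m ↦ 0`, and `T_i ↦ 1 ⊗ T_{i-m}` for `i > m`. -/
def splitGen (n m : ℕ) (i : Fin (n - 1)) : Hecke m ⊗[ℂ] Hecke (n - m) :=
  if h : i.val + 1 < m then T (n := m) ⟨i.val, by omega⟩ ⊗ₜ[ℂ] 1
  else if h' : m < i.val + 1 then 1 ⊗ₜ[ℂ] T (n := n - m) ⟨i.val - m, by omega⟩
  else 0

/-- The algebra map `H_n(0) → H_m(0) ⊗ H_{n-m}(0)` given by `splitGen`. -/
def splitHom (n m : ℕ) : Hecke n →ₐ[ℂ] Hecke m ⊗[ℂ] Hecke (n - m) :=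
  heckeLift (splitGen n m)
    (fun i => by
      unfold splitGen
      split_ifs <;> simp [T_sq])
    (fun i j h => by
      unfold splitGen
      split_ifs <;> first
        | omega
        | simp only [Algebra.TensorProduct.tmul_mul_tmul, mul_one, mul_zero, zero_mul]
      · rw [T_braid]; exact h
      · rw [T_braid]; simp only; omega)
    (fun i j h => by
      unfold splitGen
      split_ifs <;> first
        | omega
        | simp only [Algebra.TensorProduct.tmul_mul_tmul, mul_one, one_mul, mul_zero, zero_mul]
      · rw [T_comm]; exact h
      · rw [T_comm]; simp only; omega)

theorem splitHom_tensorHom {n m : ℕ} (hm : m ≤ n) (x : Hecke m ⊗[ℂ] Hecke (n - m)) :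
    splitHom n m (tensorHom hm x) = x := by
  have h : (splitHom n m).comp (tensorHom hm) = AlgHom.id ℂ _ := by
    apply Algebra.TensorProduct.ext
    · apply hecke_hom_ext
      intro i
      have : i.val + 1 < m := by omega
      simp [tensorHom, splitHom, lowHom, splitGen, lowIdx, this]
    · apply hecke_hom_ext
      intro i
      have h1 : ¬ (m + i.val + 1 < m) := by omega
      have h2 : m < m + i.val + 1 := by omega
      simp [tensorHom, splitHom, highHom, splitGen, highIdx, h1, h2]
  exact DFunLike.congr_fun h x

theorem tensorHom_splitHom {n m : ℕ} (hm : m ≤ n) (x : Hecke n) (hx : x ∈ parabolic n m) :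
    tensorHom hm (splitHom n m x) = x := by
  unfold parabolic at hx
  induction hx using Algebra.adjoin_induction with
  | mem x hx =>
    obtain ⟨i, hi, rfl⟩ := hx
    simp only [splitHom, heckeLift_T, splitGen]
    split_ifs with h1 h2
    · simp [tensorHom, lowHom, lowIdx]
    · have : m + (i.val - m) = i.val := by omega
      simp [tensorHom, highHom, highIdx, this]
    · omega
  | algebraMap r => rw [AlgHom.commutes, AlgHom.commutes]
  | add a b _ _ ha hb => rw [map_add, map_add, ha, hb]
  | mul a b _ _ ha hb => rw [map_mul, map_mul, ha, hb]

/-- The isomorphism `H_{m,n-m}(0) ≅ H_m(0) ⊗ H_{n-m}(0)` with `T_i ↦ T_i ⊗ 1` for `i < m` and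
`T_i ↦ 1 ⊗ T_{i-m}` for `i > m`. -/
def parabolicEquiv {n m : ℕ} (hm : m ≤ n) :
    parabolic n m ≃ₐ[ℂ] Hecke m ⊗[ℂ] Hecke (n - m) :=
  AlgEquiv.ofAlgHom ((splitHom n m).comp (parabolic n m).val)
    ((tensorHom hm).codRestrict (parabolic n m) (tensorHom_mem hm))
    (AlgHom.ext fun x => splitHom_tensorHom hm x)
    (AlgHom.ext fun x => Subtype.ext (tensorHom_splitHom hm x.1 x.2))

/-! ### Compositions, skew shapes and tableaux -/

/-- The covering relation of the reverse composition poset: `a` is covered by the composition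
obtained by prefixing a part `1`, and by those obtained by adding `1` to a part of `a` which is
the leftmost part of its size. -/
inductive Covers : List ℕ → List ℕ → Prop
  | prefix_one (a : List ℕ) : Covers a (1 :: a)
  | add_one (l r : List ℕ) (k : ℕ) (h : k ∉ l) : Covers (l ++ k :: r) (l ++ (k + 1) :: r)

/-- The (weak) order `β ≤_c α` of the reverse composition poset: the reflexive transitive closure
of the covering relation. -/
def CompLE {k n : ℕ} (β : Composition k) (α : Composition n) : Prop :=
  Relation.ReflTransGen Covers β.blocks α.blocks

/-- The empty composition. -/
def emptyComp : Composition 0 := ⟨[], by simp, rfl⟩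

/-- The cells of the reverse composition diagram of `α`. A cell is a pair (row, column), rows
counted from the top and columns from the left, both starting at `0`. -/
def diagram {n : ℕ} (α : Composition n) : Set (ℕ × ℕ) :=
  {x | x.2 < α.blocks.getD x.1 0}

/-- The cells of the diagram of `β`, drawn in the bottom left corner of the diagram of `α`. -/
def inner {n k : ℕ} (α : Composition n) (β : Composition k) : Set (ℕ × ℕ) :=
  {x | α.length - β.length ≤ x.1 ∧ (x.1 - (α.length - β.length), x.2) ∈ diagram β}

/-- The cells of the skew reverse composition shape `α // β`. -/
def skewCells {n k : ℕ} (α : Composition n) (β : Composition k) : Set (ℕ × ℕ) :=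
  diagram α \ inner α β

open Classical in
/-- The entry of a filling of `α // β` at a cell of `α`, with the convention that the entries in
the cells of `β` are `∞`. (Outside `α` the value is meaningless and never used.) -/
def extEntry {n k N : ℕ} {α : Composition n} {β : Composition k}
    (e : skewCells α β ≃ Fin N) (x : ℕ × ℕ) : WithTop ℕ :=
  if x ∈ inner α β then ⊤
  else if h : x ∈ skewCells α β then ((e ⟨x, h⟩ : Fin N) : ℕ)
  else 0

/-- Skew standard reverse composition tableaux of shape `α // β` and size `N`. The entries
`1, …, N` are represented by the elements `0, …, N - 1` of `Fin N`. Since the filling is bijective,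
there are none unless `N` is the number of cells of `α // β`. -/
structure SRCT {n k : ℕ} (α : Composition n) (β : Composition k) (N : ℕ) where
  /-- the bijective filling -/
  entry : skewCells α β ≃ Fin N
  row_decreasing : ∀ x y : skewCells α β, x.1.1 = y.1.1 → x.1.2 < y.1.2 → entry y < entry x
  col_increasing : ∀ x y : skewCells α β, x.1.2 = 0 → y.1.2 = 0 → x.1.1 < y.1.1 →
    entry x < entry y
  triple : ∀ i j l : ℕ, i < j → (i, l) ∈ diagram α → (j, l + 1) ∈ skewCells α β →
    extEntry entry (j, l + 1) < extEntry entry (i, l) →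
    (i, l + 1) ∈ diagram α ∧ extEntry entry (j, l + 1) < extEntry entry (i, l + 1)

namespace SRCT

variable {n k N : ℕ} {α : Composition n} {β : Composition k}

/-- The cell containing a given entry. -/
def pos (τ : SRCT α β N) (a : Fin N) : ℕ × ℕ := (τ.entry.symm a).1

/-- The entry `i` (as opposed to `i + 1`) that the operator `π_i` is concerned with. -/
def lo (i : Fin (N - 1)) : Fin N := ⟨i.val, by omega⟩

/-- The entry `i + 1` that the operator `π_i` is concerned with. -/
def hi (i : Fin (N - 1)) : Fin N := ⟨i.val + 1, by omega⟩

/-- `i` is a descent: `i + 1` appears weakly right of `i`. -/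
def IsDescent (τ : SRCT α β N) (i : Fin (N - 1)) : Prop :=
  (τ.pos (lo i)).2 ≤ (τ.pos (hi i)).2

/-- `i` and `i + 1` are attacking: they are in the same column, or in adjacent columns with `i + 1`
strictly southeast of `i`. -/
def Attacking (τ : SRCT α β N) (i : Fin (N - 1)) : Prop :=
  (τ.pos (lo i)).2 = (τ.pos (hi i)).2 ∨
    ((τ.pos (hi i)).2 = (τ.pos (lo i)).2 + 1 ∧ (τ.pos (lo i)).1 < (τ.pos (hi i)).1)

theorem ext_pos {τ τ' : SRCT α β N} (h : ∀ a, τ.pos a = τ'.pos a) : τ = τ' := by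
  have : τ.entry = τ'.entry := by
    rw [← Equiv.symm_symm τ.entry, ← Equiv.symm_symm τ'.entry]
    congr 1
    exact Equiv.ext fun a => Subtype.ext (h a)
  cases τ
  cases τ'
  simp only at this
  subst this
  rfl

theorem pos_entry (τ : SRCT α β N) (x : skewCells α β) : τ.pos (τ.entry x) = x.1 := by
  simp [pos]

theorem swap_lt_swap (i : Fin (N - 1)) (a b : Fin N) (h : ¬ (a = lo i ∧ b = hi i))
    (h' : ¬ (a = hi i ∧ b = lo i)) :
    Equiv.swap (lo i) (hi i) a < Equiv.swap (lo i) (hi i) b ↔ a < b := by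
  simp only [Equiv.swap_apply_def, lo, hi, Fin.ext_iff, Fin.lt_def] at *
  split_ifs <;> simp only <;> omega

theorem swap_lt_swap_of (i : Fin (N - 1)) (a b : Fin N) (h : ¬ (a = lo i ∧ b = hi i))
    (hab : a < b) : Equiv.swap (lo i) (hi i) a < Equiv.swap (lo i) (hi i) b := by
  rw [swap_lt_swap i a b h]
  · exact hab
  · rintro ⟨rfl, rfl⟩
    simp [lo, hi, Fin.lt_def] at hab

/-- Exchanging `i` and `i + 1` in a tableau with a non-attacking descent `i` gives a tableau. -/
def flip (τ : SRCT α β N) (i : Fin (N - 1)) (hd : τ.IsDescent i) (ha : ¬ τ.Attacking i) :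
    SRCT α β N where
  entry := τ.entry.trans (Equiv.swap (lo i) (hi i))
  row_decreasing x y hxy hlt := by
    refine swap_lt_swap_of i _ _ ?_ (τ.row_decreasing x y hxy hlt)
    rintro ⟨h1, h2⟩
    unfold IsDescent at hd
    rw [← h1, ← h2, pos_entry, pos_entry] at hd
    omega
  col_increasing x y hx hy hlt := by
    refine swap_lt_swap_of i _ _ ?_ (τ.col_increasing x y hx hy hlt)
    rintro ⟨h1, h2⟩
    unfold Attacking at ha
    rw [← h1, ← h2, pos_entry, pos_entry] at ha
    omega
  triple a b l hab hal hbl hlt := by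
    have hcol : ¬ ∃ x y : skewCells α β, x.1.2 = y.1.2 ∧ τ.entry x = lo i ∧ τ.entry y = hi i := by
      rintro ⟨x, y, h, h1, h2⟩
      unfold Attacking at ha
      rw [← h1, ← h2, pos_entry, pos_entry] at ha
      exact ha (Or.inl h)
    have hbl' : (b, l + 1) ∉ inner α β := hbl.2
    have key : extEntry τ.entry (b, l + 1) < extEntry τ.entry (a, l) := by
      by_cases hin : (a, l) ∈ inner α β
      · simp [extEntry, hin, hbl', hbl]
      · have hs : (a, l) ∈ skewCells α β := ⟨hal, hin⟩
        simp only [extEntry, hin, hbl', hbl, hs, if_false, dif_pos, Equiv.trans_apply,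
          Nat.cast_lt, Fin.val_fin_lt] at hlt ⊢
        by_cases hc : τ.entry ⟨(b, l + 1), hbl⟩ = hi i ∧ τ.entry ⟨(a, l), hs⟩ = lo i
        · exfalso
          unfold Attacking at ha
          rw [← hc.1, ← hc.2, pos_entry, pos_entry] at ha
          exact ha (Or.inr ⟨rfl, hab⟩)
        · by_contra hcon
          have hne : τ.entry ⟨(a, l), hs⟩ ≠ τ.entry ⟨(b, l + 1), hbl⟩ := by
            intro he
            have := congrArg Subtype.val (τ.entry.injective he)
            simp at this
          have hlt2 := lt_of_le_of_ne (not_lt.mp hcon) hne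
          exact lt_asymm hlt (swap_lt_swap_of i _ _ (fun h => hc ⟨h.2, h.1⟩) hlt2)
    obtain ⟨h1, h2⟩ := τ.triple a b l hab hal hbl key
    refine ⟨h1, ?_⟩
    by_cases hin : (a, l + 1) ∈ inner α β
    · simp [extEntry, hin, hbl', hbl]
    · have hs : (a, l + 1) ∈ skewCells α β := ⟨h1, hin⟩
      simp only [extEntry, hin, hbl', hbl, hs, if_false, dif_pos, Equiv.trans_apply,
        Nat.cast_lt, Fin.val_fin_lt] at h2 ⊢
      refine swap_lt_swap_of i _ _ ?_ h2
      rintro ⟨h3, h4⟩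
      exact hcol ⟨⟨(b, l + 1), hbl⟩, ⟨(a, l + 1), hs⟩, rfl, h3, h4⟩

theorem pos_flip (τ : SRCT α β N) (i : Fin (N - 1)) (hd : τ.IsDescent i) (ha : ¬ τ.Attacking i)
    (a : Fin N) : (τ.flip i hd ha).pos a = τ.pos (Equiv.swap (lo i) (hi i) a) := rfl

open Classical in
/-- The value of the operator `π_i` at a tableau, in the space spanned by the tableaux. -/
def piVal (i : Fin (N - 1)) (τ : SRCT α β N) : SRCT α β N →₀ ℂ :=
  if hd : τ.IsDescent i then
    if ha : τ.Attacking i then 0 else Finsupp.single (τ.flip i hd ha) 1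
  else Finsupp.single τ 1

/-- The operator `π_i`, extended linearly. -/
def piOp (i : Fin (N - 1)) : Module.End ℂ (SRCT α β N →₀ ℂ) :=
  Finsupp.linearCombination ℂ (piVal i)

theorem piOp_single (i : Fin (N - 1)) (τ : SRCT α β N) :
    piOp i (Finsupp.single τ 1) = piVal i τ := by
  simp [piOp]

theorem piVal_cases (i : Fin (N - 1)) (τ : SRCT α β N) :
    ((τ.pos (hi i)).2 < (τ.pos (lo i)).2 ∧ piVal i τ = Finsupp.single τ 1) ∨
    (((τ.pos (lo i)).2 = (τ.pos (hi i)).2 ∨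
      ((τ.pos (hi i)).2 = (τ.pos (lo i)).2 + 1 ∧ (τ.pos (lo i)).1 < (τ.pos (hi i)).1)) ∧
      piVal i τ = 0) ∨
    ((τ.pos (lo i)).2 < (τ.pos (hi i)).2 ∧
      ¬ ((τ.pos (hi i)).2 = (τ.pos (lo i)).2 + 1 ∧ (τ.pos (lo i)).1 < (τ.pos (hi i)).1) ∧
      ∃ τ' : SRCT α β N, (∀ a, τ'.pos a = τ.pos (Equiv.swap (lo i) (hi i) a)) ∧
        piVal i τ = Finsupp.single τ' 1) := by
  by_cases hd : τ.IsDescent i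
  · by_cases ha : τ.Attacking i
    · exact Or.inr (Or.inl ⟨ha, by simp [piVal, hd, ha]⟩)
    · refine Or.inr (Or.inr ⟨?_, fun h => ha (Or.inr h), τ.flip i hd ha, fun a => rfl,
        by simp [piVal, hd, ha]⟩)
      exact lt_of_le_of_ne hd fun h => ha (Or.inl h)
  · exact Or.inl ⟨not_le.mp hd, by simp [piVal, hd]⟩

theorem piVal_fix {i : Fin (N - 1)} {τ : SRCT α β N}
    (h : (τ.pos (hi i)).2 < (τ.pos (lo i)).2) : piVal i τ = Finsupp.single τ 1 := by
  simp [piVal, IsDescent, not_le.mpr h]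

theorem piOp_sq (i : Fin (N - 1)) :
    (piOp i * piOp i : Module.End ℂ (SRCT α β N →₀ ℂ)) = piOp i := by
  refine Finsupp.lhom_ext' fun τ => LinearMap.ext_ring ?_
  simp only [LinearMap.comp_apply, Finsupp.lsingle_apply, Module.End.mul_apply, piOp_single]
  rcases piVal_cases i τ with ⟨_, h⟩ | ⟨_, h⟩ | ⟨h1, _, τ', hp, h⟩
  · rw [h, piOp_single, h]
  · rw [h, map_zero]
  · rw [h, piOp_single]
    apply piVal_fix
    rw [hp, hp, Equiv.swap_apply_left, Equiv.swap_apply_right]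
    exact h1

set_option linter.unusedSimpArgs false in
theorem piOp_comm (i j : Fin (N - 1)) (hij : i.val + 2 ≤ j.val) :
    (piOp i * piOp j : Module.End ℂ (SRCT α β N →₀ ℂ)) = piOp j * piOp i := by
  have n1 : lo i ≠ lo j := by simp only [lo, ne_eq, Fin.mk.injEq]; omega
  have n2 : lo i ≠ hi j := by simp only [lo, hi, ne_eq, Fin.mk.injEq]; omega
  have n3 : hi i ≠ lo j := by simp only [lo, hi, ne_eq, Fin.mk.injEq]; omega
  have n4 : hi i ≠ hi j := by simp only [hi, ne_eq, Fin.mk.injEq]; omega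
  have e1 : Equiv.swap (lo i) (hi i) (lo j) = lo j :=
    Equiv.swap_apply_of_ne_of_ne n1.symm n3.symm
  have e2 : Equiv.swap (lo i) (hi i) (hi j) = hi j :=
    Equiv.swap_apply_of_ne_of_ne n2.symm n4.symm
  have e3 : Equiv.swap (lo j) (hi j) (lo i) = lo i := Equiv.swap_apply_of_ne_of_ne n1 n2
  have e4 : Equiv.swap (lo j) (hi j) (hi i) = hi i := Equiv.swap_apply_of_ne_of_ne n3 n4
  have es : ∀ a, Equiv.swap (lo j) (hi j) (Equiv.swap (lo i) (hi i) a) =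
      Equiv.swap (lo i) (hi i) (Equiv.swap (lo j) (hi j) a) := by
    intro a
    simp only [Equiv.swap_apply_def, lo, hi, Fin.ext_iff]
    split_ifs <;> first | rfl | (simp only at *; omega)
  refine Finsupp.lhom_ext' fun τ => LinearMap.ext_ring ?_
  simp only [LinearMap.comp_apply, Finsupp.lsingle_apply, Module.End.mul_apply, piOp_single]
  rcases piVal_cases i τ with ⟨a, h⟩ | ⟨a, h⟩ | ⟨a, a', τ₁, p, h⟩ <;>
  rcases piVal_cases j τ with ⟨b, g⟩ | ⟨b, g⟩ | ⟨b, b', τ₂, q, g⟩ <;>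
  simp only [h, g, map_zero, piOp_single]
  · rcases piVal_cases i τ₂ with ⟨c, k⟩ | ⟨c, k⟩ | ⟨c, c', τ₃, r, k⟩ <;>
    simp only [q, e3, e4] at c <;>
    (try simp only [q, e3, e4] at c') <;> first | exact k | omega
  · rcases piVal_cases i τ₂ with ⟨c, k⟩ | ⟨c, k⟩ | ⟨c, c', τ₃, r, k⟩ <;>
    simp only [q, e3, e4] at c <;>
    (try simp only [q, e3, e4] at c') <;> first | exact k | omega
  · rcases piVal_cases j τ₁ with ⟨c, k⟩ | ⟨c, k⟩ | ⟨c, c', τ₃, r, k⟩ <;>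
    simp only [p, e1, e2] at c <;>
    (try simp only [p, e1, e2] at c') <;> first | exact k.symm | omega
  · rcases piVal_cases j τ₁ with ⟨c, k⟩ | ⟨c, k⟩ | ⟨c, c', τ₃, r, k⟩ <;>
    simp only [p, e1, e2] at c <;>
    (try simp only [p, e1, e2] at c') <;> first | exact k.symm | omega
  · rcases piVal_cases i τ₂ with ⟨c, k⟩ | ⟨c, k⟩ | ⟨c, c', τ₃, r, k⟩ <;>
    simp only [q, e3, e4] at c <;>
    (try simp only [q, e3, e4] at c') <;> first | omega | skip
    rcases piVal_cases j τ₁ with ⟨d, l⟩ | ⟨d, l⟩ | ⟨d, d', τ₄, t, l⟩ <;>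
    simp only [p, e1, e2] at d <;>
    (try simp only [p, e1, e2] at d') <;> first | omega | skip
    rw [k, l]
    congr 1
    apply ext_pos
    intro x
    rw [r, q, t, p, es]

set_option linter.unusedSimpArgs false in
theorem piOp_braid (i j : Fin (N - 1)) (hij : i.val + 1 = j.val) :
    (piOp i * piOp j * piOp i : Module.End ℂ (SRCT α β N →₀ ℂ)) =
      piOp j * piOp i * piOp j := by
  obtain ⟨u, hu⟩ : ∃ u, u = lo i := ⟨_, rfl⟩
  obtain ⟨v, hv⟩ : ∃ v, v = hi i := ⟨_, rfl⟩
  obtain ⟨w, hw⟩ : ∃ w, w = hi j := ⟨_, rfl⟩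
  have hv' : lo j = v := by rw [hv]; simp only [lo, hi, Fin.mk.injEq]; omega
  have n1 : u ≠ v := by rw [hu, hv]; simp only [lo, hi, ne_eq, Fin.mk.injEq]; omega
  have n2 : u ≠ w := by rw [hu, hw]; simp only [lo, hi, ne_eq, Fin.mk.injEq]; omega
  have n3 : v ≠ w := by rw [hv, hw]; simp only [hi, ne_eq, Fin.mk.injEq]; omega
  have e1 : Equiv.swap u v w = w := Equiv.swap_apply_of_ne_of_ne n2.symm n3.symm
  have e2 : Equiv.swap v w u = u := Equiv.swap_apply_of_ne_of_ne n1 n2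
  have es : ∀ a, Equiv.swap u v (Equiv.swap v w (Equiv.swap u v a)) =
      Equiv.swap v w (Equiv.swap u v (Equiv.swap v w a)) := by
    intro a
    by_cases h1 : a = u
    · subst h1; simp [e2, e1]
    by_cases h2 : a = v
    · subst h2; simp [e2, e1]
    by_cases h3 : a = w
    · subst h3; simp [e2, e1]
    · rw [Equiv.swap_apply_of_ne_of_ne h1 h2, Equiv.swap_apply_of_ne_of_ne h2 h3,
        Equiv.swap_apply_of_ne_of_ne h1 h2, Equiv.swap_apply_of_ne_of_ne h2 h3]
  have ci := fun τ : SRCT α β N => piVal_cases i τ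
  have cj := fun τ : SRCT α β N => piVal_cases j τ
  simp only [← hu, ← hv, ← hw, hv'] at ci cj
  refine Finsupp.lhom_ext' fun τ => LinearMap.ext_ring ?_
  simp only [LinearMap.comp_apply, Finsupp.lsingle_apply, Module.End.mul_apply, piOp_single]
  rcases ci τ with ⟨a, h⟩ | ⟨a, h⟩ | ⟨a, a', τ₁, p, h⟩ <;>
  rcases cj τ with ⟨b, g⟩ | ⟨b, g⟩ | ⟨b, b', τ₂, q, g⟩ <;>
  simp only [h, g, map_zero, piOp_single]
  · -- fixed by `π_i`, flipped by `π_j`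
    rcases ci τ₂ with ⟨c, k⟩ | ⟨c, k⟩ | ⟨c, c', τ₃, r, k⟩ <;>
    simp only [q, e2, Equiv.swap_apply_left, Equiv.swap_apply_right] at c <;>
    (try simp only [q, e2, Equiv.swap_apply_left, Equiv.swap_apply_right] at c') <;>
    simp only [k, map_zero, piOp_single]
    · rcases cj τ₂ with ⟨d, l⟩ | ⟨d, l⟩ | ⟨d, d', τ₄, t, l⟩ <;>
      simp only [q, e2, Equiv.swap_apply_left, Equiv.swap_apply_right] at d <;>
    (try simp only [q, e2, Equiv.swap_apply_left, Equiv.swap_apply_right] at d') <;>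
      first | exact l.symm | omega
    · rcases cj τ₃ with ⟨d, l⟩ | ⟨d, l⟩ | ⟨d, d', τ₄, t, l⟩ <;>
      simp only [r, q, e1, e2, Equiv.swap_apply_left, Equiv.swap_apply_right] at d <;>
    (try simp only [r, q, e1, e2, Equiv.swap_apply_left, Equiv.swap_apply_right] at d') <;>
      first | exact l.symm | omega
  · -- killed by `π_i`, flipped by `π_j`
    rcases ci τ₂ with ⟨c, k⟩ | ⟨c, k⟩ | ⟨c, c', τ₃, r, k⟩ <;>
    simp only [q, e2, Equiv.swap_apply_left, Equiv.swap_apply_right] at c <;>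
    (try simp only [q, e2, Equiv.swap_apply_left, Equiv.swap_apply_right] at c') <;>
    simp only [k, map_zero, piOp_single]
    · omega
    · rcases cj τ₃ with ⟨d, l⟩ | ⟨d, l⟩ | ⟨d, d', τ₄, t, l⟩ <;>
      simp only [r, q, e1, e2, Equiv.swap_apply_left, Equiv.swap_apply_right] at d <;>
    (try simp only [r, q, e1, e2, Equiv.swap_apply_left, Equiv.swap_apply_right] at d') <;>
      first | exact l.symm | omega
  · -- flipped by `π_i`, fixed by `π_j`
    rcases cj τ₁ with ⟨c, k⟩ | ⟨c, k⟩ | ⟨c, c', τ₃, r, k⟩ <;>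
    simp only [p, e1, Equiv.swap_apply_left, Equiv.swap_apply_right] at c <;>
    (try simp only [p, e1, Equiv.swap_apply_left, Equiv.swap_apply_right] at c') <;>
    simp only [k, map_zero, piOp_single]
    · rcases ci τ₁ with ⟨d, l⟩ | ⟨d, l⟩ | ⟨d, d', τ₄, t, l⟩ <;>
      simp only [p, Equiv.swap_apply_left, Equiv.swap_apply_right] at d <;>
    (try simp only [p, Equiv.swap_apply_left, Equiv.swap_apply_right] at d') <;>
      first | exact l | omega
    · rcases ci τ₃ with ⟨d, l⟩ | ⟨d, l⟩ | ⟨d, d', τ₄, t, l⟩ <;>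
      simp only [r, p, e1, e2, Equiv.swap_apply_left, Equiv.swap_apply_right] at d <;>
    (try simp only [r, p, e1, e2, Equiv.swap_apply_left, Equiv.swap_apply_right] at d') <;>
      first | exact l | omega
  · -- flipped by `π_i`, killed by `π_j`
    rcases cj τ₁ with ⟨c, k⟩ | ⟨c, k⟩ | ⟨c, c', τ₃, r, k⟩ <;>
    simp only [p, e1, Equiv.swap_apply_left, Equiv.swap_apply_right] at c <;>
    (try simp only [p, e1, Equiv.swap_apply_left, Equiv.swap_apply_right] at c') <;>
    simp only [k, map_zero, piOp_single]
    · omega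
    · rcases ci τ₃ with ⟨d, l⟩ | ⟨d, l⟩ | ⟨d, d', τ₄, t, l⟩ <;>
      simp only [r, p, e1, e2, Equiv.swap_apply_left, Equiv.swap_apply_right] at d <;>
    (try simp only [r, p, e1, e2, Equiv.swap_apply_left, Equiv.swap_apply_right] at d') <;>
      first | exact l | omega
  · -- flipped by both
    rcases cj τ₁ with ⟨c, k⟩ | ⟨c, k⟩ | ⟨c, c', τ₃, r, k⟩ <;>
    simp only [p, e1, Equiv.swap_apply_left, Equiv.swap_apply_right] at c <;>
    (try simp only [p, e1, Equiv.swap_apply_left, Equiv.swap_apply_right] at c') <;>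
    first | omega | skip
    rcases ci τ₂ with ⟨d, l⟩ | ⟨d, l⟩ | ⟨d, d', τ₄, t, l⟩ <;>
    simp only [q, e2, Equiv.swap_apply_left, Equiv.swap_apply_right] at d <;>
    (try simp only [q, e2, Equiv.swap_apply_left, Equiv.swap_apply_right] at d') <;>
    first | omega | skip
    simp only [k, l, piOp_single]
    rcases ci τ₃ with ⟨y, m⟩ | ⟨y, m⟩ | ⟨y, y', τ₅, z, m⟩ <;>
    simp only [r, p, e1, e2, Equiv.swap_apply_left, Equiv.swap_apply_right] at y <;>
    (try simp only [r, p, e1, e2, Equiv.swap_apply_left, Equiv.swap_apply_right] at y') <;>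
    first | omega | skip
    · rcases cj τ₄ with ⟨y₂, m₂⟩ | ⟨y₂, m₂⟩ | ⟨y₂, y₂', τ₆, z₂, m₂⟩ <;>
      simp only [t, q, e1, e2, Equiv.swap_apply_left, Equiv.swap_apply_right] at y₂ <;>
    (try simp only [t, q, e1, e2, Equiv.swap_apply_left, Equiv.swap_apply_right] at y₂') <;>
      first | omega | skip
      rw [m, m₂]
      congr 1
      apply ext_pos
      intro x
      rw [z, r, p, z₂, t, q, es]

end SRCT

/-! ### The modules -/

/-- The space `S_{α // β}`: the `ℂ`-linear span of all skew SRCTs of shape `α // β`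
(of size `N`). -/
def SkewModule {n k : ℕ} (α : Composition n) (β : Composition k) (N : ℕ) : Type :=
  SRCT α β N →₀ ℂ

section

variable {n k N : ℕ} (α : Composition n) (β : Composition k)

instance : AddCommGroup (SkewModule α β N) := inferInstanceAs (AddCommGroup (SRCT α β N →₀ ℂ))

instance : Module ℂ (SkewModule α β N) := inferInstanceAs (Module ℂ (SRCT α β N →₀ ℂ))

/-- The tableau `τ` as a basis element of `S_{α // β}`. -/
def tab {α : Composition n} {β : Composition k} (τ : SRCT α β N) : SkewModule α β N :=
  Finsupp.single τ (1 : ℂ)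

/-- The action of `H_N(0)` on `S_{α // β}`: the generator `T_i` acts by `π_i`. -/
def skewRep : Hecke N →ₐ[ℂ] Module.End ℂ (SkewModule α β N) :=
  heckeLift (A := Module.End ℂ (SRCT α β N →₀ ℂ)) SRCT.piOp SRCT.piOp_sq SRCT.piOp_braid
    SRCT.piOp_comm

instance : Module (Hecke N) (SkewModule α β N) :=
  Module.compHom (SkewModule α β N) (skewRep α β).toRingHom

theorem smul_def (h : Hecke N) (x : SkewModule α β N) : h • x = skewRep α β h x := rfl

/-- A generator acts on a basis element by the operator `π_i`. -/
theorem T_smul_tab {α : Composition n} {β : Composition k} (i : Fin (N - 1)) (τ : SRCT α β N) :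
    (T i : Hecke N) • tab τ = SRCT.piVal i τ := by
  have h := heckeLift_T (A := Module.End ℂ (SRCT α β N →₀ ℂ)) SRCT.piOp SRCT.piOp_sq
    SRCT.piOp_braid SRCT.piOp_comm i
  exact (DFunLike.congr_fun h (Finsupp.single τ 1)).trans (SRCT.piOp_single i τ)

end

/-- The `H_n(0)`-module `S_α = S_{α // ∅}`. -/
abbrev StraightModule {n : ℕ} (α : Composition n) : Type := SkewModule α emptyComp n

/-- The restriction of `S_α` to `H_{m,n-m}(0)`, viewed as an `H_m(0) ⊗ H_{n-m}(0)`-module through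
`H_{m,n-m}(0) ≅ H_m(0) ⊗ H_{n-m}(0)`. -/
def Restricted {n m : ℕ} (α : Composition n) (_ : m ≤ n) : Type := StraightModule α

section

variable {n m : ℕ} (α : Composition n) (hm : m ≤ n)

instance : AddCommGroup (Restricted α hm) := inferInstanceAs (AddCommGroup (StraightModule α))

/-- `S_α` as a module over the subalgebra `H_{m,n-m}(0)` of `H_n(0)`. -/
instance : Module (parabolic n m) (Restricted α hm) :=
  inferInstanceAs (Module (parabolic n m) (StraightModule α))

instance : Module (Hecke m ⊗[ℂ] Hecke (n - m)) (Restricted α hm) :=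
  Module.compHom (Restricted α hm) (parabolicEquiv hm).symm.toAlgHom.toRingHom

/-- The identity map from `S_α` to its restriction. -/
def toRestricted : StraightModule α ≃+ Restricted α hm := AddEquiv.refl _

theorem restricted_smul (x : Hecke m ⊗[ℂ] Hecke (n - m)) (v : StraightModule α) :
    x • toRestricted α hm v =
      toRestricted α hm (((parabolicEquiv hm).symm x : Hecke n) • v) := rfl

end

/-- The vector space `S_{α // β} ⊗ S_γ`. -/
def OuterTensor {n k l : ℕ} (α : Composition n) (β : Composition k) (N : ℕ)
    (γ : Composition l) : Type :=
  SkewModule α β N ⊗[ℂ] StraightModule γ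

section

variable {n k l N : ℕ} (α : Composition n) (β : Composition k) (γ : Composition l)

instance : AddCommGroup (OuterTensor α β N γ) :=
  inferInstanceAs (AddCommGroup (SkewModule α β N ⊗[ℂ] StraightModule γ))

/-- The action of `H_N(0) ⊗ H_l(0)` on `S_{α // β} ⊗ S_γ`,
`(a ⊗ b) (x ⊗ y) = (a x) ⊗ (b y)`. -/
def outerRep :
    Hecke N ⊗[ℂ] Hecke l →ₐ[ℂ] Module.End ℂ (SkewModule α β N ⊗[ℂ] StraightModule γ) :=
  Module.endTensorEndAlgHom.comp
    (Algebra.TensorProduct.map (skewRep α β) (skewRep γ emptyComp))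

instance : Module (Hecke N ⊗[ℂ] Hecke l) (OuterTensor α β N γ) :=
  Module.compHom (SkewModule α β N ⊗[ℂ] StraightModule γ) (outerRep α β γ).toRingHom

/-- The identity map from the tensor product of vector spaces to `OuterTensor`. -/
def toOuter : SkewModule α β N ⊗[ℂ] StraightModule γ ≃+ OuterTensor α β N γ := AddEquiv.refl _

theorem outer_smul_tmul (a : Hecke N) (b : Hecke l) (x : SkewModule α β N)
    (y : StraightModule γ) :
    (a ⊗ₜ[ℂ] b) • toOuter α β γ (x ⊗ₜ[ℂ] y) = toOuter α β γ ((a • x) ⊗ₜ[ℂ] (b • y)) := by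
  change outerRep α β γ (a ⊗ₜ[ℂ] b) (x ⊗ₜ[ℂ] y) = (a • x) ⊗ₜ[ℂ] (b • y)
  simp only [outerRep, AlgHom.comp_apply, Algebra.TensorProduct.map_tmul, smul_def]
  rfl

end

end

end ZeroHecke

/-! The restriction is already visible on bases. Given a tableau of shape `α`, cut it into its `m`
smallest entries and its `n - m` largest ones. The large entries fill the diagram of a composition
`β` in the bottom left corner, and form a tableau of shape `β`; the small ones form a skew tableau
of shape `α // β`. Conversely, any such pair glues back to one tableau of shape `α`.

The combinatorial core is `IsTableau.exists_blocks`: the region of the large entries is a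
composition below `α` in the reverse composition order. Delete entries in increasing order. Rows
decrease, so the smallest remaining entry ends its row. If it lies in the first column, then it is
in the top row, because the first column increases: the deletion undoes the prefixing of a part `1`.
Otherwise a row of length `k + 1` shrinks to `k`, and the triple condition forbids a higher row of
length `k`: the deletion undoes the other kind of covering.

Gluing itself needs only containment of `β` in `α` (`FitsIn`). The convention `∞` on `β` records
that every entry put there exceeds every entry of the skew part, so the triple conditions before and
after gluing match. The cells of `β` can be read off from the glued tableau, and they determine `β`;
hence gluing is a bijection of bases (`glueEquiv`).

Finally, `T_i` looks only at the relative position of two consecutive entries. For `i ≠ m` both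
belong to the same part, and moving `β` into the corner of `α` shifts all its rows equally. So
gluing commutes with the generators of both tensor factors, and therefore with the whole algebra. -/

namespace ZeroHecke

noncomputable section

/-! ### Containment of compositions -/

/-- Row lengths of `a` are bounded by those of `b`, both lists being aligned at the end. -/
def FitsIn (a b : List ℕ) : Prop :=
  a.length ≤ b.length ∧ ∀ i, a.getD i 0 ≤ b.getD (i + (b.length - a.length)) 0

theorem FitsIn.refl (a : List ℕ) : FitsIn a a := ⟨le_rfl, fun i => by simp⟩

theorem FitsIn.trans {a b c : List ℕ} (h : FitsIn a b) (h' : FitsIn b c) : FitsIn a c := by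
  refine ⟨h.1.trans h'.1, fun i => (h.2 i).trans ((h'.2 _).trans (le_of_eq ?_))⟩
  have := h.1
  have := h'.1
  congr 1
  omega

theorem Covers.fitsIn {a b : List ℕ} (h : Covers a b) : FitsIn a b := by
  cases h with
  | prefix_one => exact ⟨by simp, fun i => by simp⟩
  | add_one l r k h =>
    refine ⟨by simp, fun i => ?_⟩
    simp only [List.length_append, List.length_cons, Nat.sub_self, Nat.add_zero]
    rcases lt_trichotomy i l.length with h | h | h
    · rw [List.getD_append _ _ _ _ h, List.getD_append _ _ _ _ h]
    · subst h
      simp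
    · rw [List.getD_append_right _ _ _ _ h.le, List.getD_append_right _ _ _ _ h.le]
      obtain ⟨d, hd⟩ : ∃ d, i - l.length = d + 1 := ⟨i - l.length - 1, by omega⟩
      simp [hd]

theorem FitsIn.of_reflTransGen {a b : List ℕ} (h : Relation.ReflTransGen Covers a b) :
    FitsIn a b := by
  induction h with
  | refl => exact .refl a
  | tail _ h ih => exact ih.trans h.fitsIn

theorem CompLE.fitsIn {n k : ℕ} {β : Composition k} {α : Composition n} (h : CompLE β α) :
    FitsIn β.blocks α.blocks := .of_reflTransGen h

/-! ### Cells of a composition drawn in the bottom left corner -/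

/-- The cells of the diagram with row lengths `b`, its last row being the row `L - 1`. -/
def bottomCells (L : ℕ) (b : List ℕ) : Set (ℕ × ℕ) :=
  {x | L - b.length ≤ x.1 ∧ x.2 < b.getD (x.1 - (L - b.length)) 0}

theorem mem_diagram_of_mem_bottomCells {n : ℕ} {α : Composition n} {b : List ℕ}
    (h : FitsIn b α.blocks) {x : ℕ × ℕ} (hx : x ∈ bottomCells α.length b) : x ∈ diagram α := by
  refine lt_of_lt_of_le hx.2 ((h.2 _).trans (le_of_eq ?_))
  have := hx.1
  congr 1
  simp only [Composition.length] at *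
  omega

/-- Since parts are positive, the first cell of the top row is present and reveals the number of
rows; the occupied columns of each row then reveal its length. Without positivity, leading zero
parts would be invisible. -/
theorem bottomCells_injective {L : ℕ} {a b : List ℕ} (ha : a.length ≤ L) (hb : b.length ≤ L)
    (ha' : ∀ i ∈ a, 0 < i) (hb' : ∀ i ∈ b, 0 < i) (h : bottomCells L a = bottomCells L b) :
    a = b := by
  have key : ∀ c d : List ℕ, c.length ≤ L → d.length ≤ L → (∀ i ∈ c, 0 < i) →
      bottomCells L c = bottomCells L d → c.length ≤ d.length := by
    intro c d hc hd hpos h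
    by_contra hlt
    have hm : (L - c.length, 0) ∈ bottomCells L c := by
      refine ⟨le_rfl, ?_⟩
      simp only [Nat.sub_self]
      have hp : 0 < c.length := by omega
      rw [List.getD_eq_getElem _ _ hp]
      exact hpos _ (List.getElem_mem hp)
    rw [h] at hm
    have := hm.1
    simp only at this
    omega
  have hlen : a.length = b.length :=
    le_antisymm (key a b ha hb ha' h) (key b a hb ha hb' h.symm)
  refine List.ext_getElem hlen fun i h1 h2 => ?_
  have hi : ∀ c, c < a[i] ↔ c < b[i] := by
    intro c
    have := Set.ext_iff.mp h (L - a.length + i, c)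
    have hle : L ≤ L - b.length + i + b.length := by omega
    simpa [bottomCells, hlen, h1, h2, hle] using this
  have := hi a[i]
  have := hi b[i]
  omega

theorem getD_pos {b : List ℕ} (hb : ∀ i ∈ b, 0 < i) {i : ℕ} (hi : i < b.length) :
    0 < b.getD i 0 := by
  rw [List.getD_eq_getElem _ _ hi]
  exact hb _ (List.getElem_mem hi)

theorem lt_length_of_lt_getD {b : List ℕ} {i c : ℕ} (h : c < b.getD i 0) : i < b.length := by
  by_contra hn
  rw [List.getD_eq_default _ _ (not_lt.mp hn)] at h
  omega

theorem inner_emptyComp {n : ℕ} (α : Composition n) : inner α emptyComp = ∅ := by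
  ext x
  simp [inner, diagram, emptyComp]

theorem skewCells_emptyComp {n : ℕ} (α : Composition n) : skewCells α emptyComp = diagram α := by
  simp [skewCells, inner_emptyComp]

/-! ### Tableaux in terms of the positions of their entries -/

/-- `p` lists the positions of the entries of a skew SRCT of shape `α // β`. -/
structure IsTableau {n k N : ℕ} (α : Composition n) (β : Composition k) (p : Fin N → ℕ × ℕ) :
    Prop where
  injective : Function.Injective p
  mem_iff : ∀ x, x ∈ skewCells α β ↔ ∃ a, p a = x
  row : ∀ a b, (p a).1 = (p b).1 → (p a).2 < (p b).2 → b < a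
  col : ∀ a b, (p a).2 = 0 → (p b).2 = 0 → (p a).1 < (p b).1 → a < b
  triple : ∀ i j l b, i < j → (i, l) ∈ diagram α → p b = (j, l + 1) →
    ((i, l) ∈ inner α β ∨ ∃ a, p a = (i, l) ∧ b < a) →
    (i, l + 1) ∈ diagram α ∧ ((i, l + 1) ∈ inner α β ∨ ∃ a, p a = (i, l + 1) ∧ b < a)

namespace SRCT

variable {n k N : ℕ} {α : Composition n} {β : Composition k}

theorem pos_mem (τ : SRCT α β N) (a : Fin N) : τ.pos a ∈ skewCells α β := (τ.entry.symm a).2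

theorem entry_eq_iff (e : skewCells α β ≃ Fin N) (x : skewCells α β) (a : Fin N) :
    e x = a ↔ (e.symm a).1 = x.1 := by
  rw [← Subtype.ext_iff, Equiv.symm_apply_eq, eq_comm]

/-- In the triple condition the smaller side of each comparison is a genuine entry, so `∞` occurs
only on the larger side. The comparison thus becomes a disjunction, with no extended values left. -/
theorem extEntry_lt_iff (e : skewCells α β ≃ Fin N) (b : Fin N) {x : ℕ × ℕ}
    (hx : x ∈ diagram α) : extEntry e (e.symm b).1 < extEntry e x ↔
      (x ∈ inner α β ∨ ∃ a, (e.symm a).1 = x ∧ b < a) := by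
  have h1 : (e.symm b).1 ∉ inner α β := (e.symm b).2.2
  have h2 : (e.symm b).1 ∈ skewCells α β := (e.symm b).2
  by_cases hin : x ∈ inner α β
  · simp [extEntry, hin, h1, h2]
  · have hs : x ∈ skewCells α β := ⟨hx, hin⟩
    simp only [extEntry, h1, h2, hin, hs, if_false, dif_pos, Subtype.coe_eta,
      Equiv.apply_symm_apply, Nat.cast_lt, Fin.val_fin_lt, false_or]
    constructor
    · intro h
      exact ⟨e ⟨x, hs⟩, by simp, h⟩
    · rintro ⟨a, ha, hab⟩
      rwa [(entry_eq_iff e ⟨x, hs⟩ a).mpr ha]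

theorem isTableau_pos (τ : SRCT α β N) : IsTableau α β τ.pos where
  injective a b h := τ.entry.symm.injective (Subtype.ext h)
  mem_iff x := ⟨fun h => ⟨τ.entry ⟨x, h⟩, τ.pos_entry ⟨x, h⟩⟩, by
    rintro ⟨a, rfl⟩; exact τ.pos_mem a⟩
  row a b h h' := by
    simpa using τ.row_decreasing (τ.entry.symm a) (τ.entry.symm b) h h'
  col a b h h' h'' := by
    simpa using τ.col_increasing (τ.entry.symm a) (τ.entry.symm b) h h' h''
  triple i j l b hij hil hb h := by
    have hs : (j, l + 1) ∈ skewCells α β := hb ▸ τ.pos_mem b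
    have hb' : (τ.entry.symm b).1 = (j, l + 1) := hb
    have ht := τ.triple i j l hij hil hs
    rw [← hb', extEntry_lt_iff _ _ hil] at ht
    obtain ⟨h1, h2⟩ := ht h
    exact ⟨h1, (extEntry_lt_iff _ _ h1).mp h2⟩

end SRCT

/-- Converse of `SRCT.isTableau_pos`. Tableaux may therefore be cut and glued as plain functions
from entries to cells, without handling bijections between different sets of cells. -/
theorem IsTableau.exists_pos_eq {n k N : ℕ} {α : Composition n} {β : Composition k}
    {p : Fin N → ℕ × ℕ} (hp : IsTableau α β p) : ∃ τ : SRCT α β N, τ.pos = p := by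
  let f : Fin N → skewCells α β := fun a => ⟨p a, (hp.mem_iff _).mpr ⟨a, rfl⟩⟩
  have hf : Function.Bijective f := by
    refine ⟨fun a b h => hp.injective (congrArg Subtype.val h), fun x => ?_⟩
    obtain ⟨a, ha⟩ := (hp.mem_iff _).mp x.2
    exact ⟨a, Subtype.ext ha⟩
  let e : skewCells α β ≃ Fin N := (Equiv.ofBijective f hf).symm
  have he : ∀ a, (e.symm a).1 = p a := fun a => rfl
  have he' : ∀ x, p (e x) = x.1 := fun x => by rw [← he, e.symm_apply_apply]
  refine ⟨⟨e, fun x y h h' => ?_, fun x y h h' h'' => ?_, fun i j l hij hil hjl h => ?_⟩, rfl⟩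
  · exact hp.row _ _ (by rwa [he', he']) (by rwa [he', he'])
  · exact hp.col _ _ (by rwa [he']) (by rwa [he']) (by rwa [he', he'])
  · have hb : (e.symm (e ⟨(j, l + 1), hjl⟩)).1 = (j, l + 1) := by simp
    rw [← hb, SRCT.extEntry_lt_iff e _ hil] at h
    obtain ⟨h1, h2⟩ := hp.triple i j l _ hij hil (he' ⟨(j, l + 1), hjl⟩) h
    refine ⟨h1, ?_⟩
    rw [← hb, SRCT.extEntry_lt_iff e _ h1]
    exact h2

/-! ### Gluing a skew tableau and a straight tableau -/

/-- The `i`-th of the `m` smallest elements of `Fin n`. -/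
def lowEntry {n m : ℕ} (hm : m ≤ n) (i : Fin m) : Fin n := ⟨i.val, by omega⟩

/-- The `i`-th of the `n - m` largest elements of `Fin n`. -/
def highEntry {n m : ℕ} (hm : m ≤ n) (i : Fin (n - m)) : Fin n := ⟨m + i.val, by omega⟩

theorem eq_lowEntry_or_eq_highEntry {n m : ℕ} (hm : m ≤ n) (a : Fin n) :
    (∃ i, a = lowEntry hm i) ∨ ∃ i, a = highEntry hm i := by
  by_cases h : a.val < m
  · exact Or.inl ⟨⟨a.val, h⟩, rfl⟩
  · exact Or.inr ⟨⟨a.val - m, by omega⟩, Fin.ext (by simp only [highEntry]; omega)⟩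

section entries

variable {n m : ℕ} (hm : m ≤ n)

@[simp] theorem lowEntry_lt_lowEntry (i j : Fin m) :
    lowEntry hm i < lowEntry hm j ↔ i < j := Iff.rfl

@[simp] theorem highEntry_lt_highEntry (i j : Fin (n - m)) :
    highEntry hm i < highEntry hm j ↔ i < j := by
  simp only [highEntry, Fin.lt_def]
  omega

@[simp] theorem lowEntry_lt_highEntry (i : Fin m) (j : Fin (n - m)) :
    lowEntry hm i < highEntry hm j := by
  simp only [lowEntry, highEntry, Fin.lt_def]
  omega

@[simp] theorem not_highEntry_lt_lowEntry (i : Fin m) (j : Fin (n - m)) :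
    ¬ highEntry hm j < lowEntry hm i := (lowEntry_lt_highEntry hm i j).not_gt

theorem lowEntry_injective : Function.Injective (lowEntry hm) := fun _ _ h =>
  Fin.ext (congrArg (fun a : Fin n => a.val) h)

theorem highEntry_injective : Function.Injective (highEntry hm) := fun i j h => by
  have := congrArg (fun a : Fin n => a.val) h
  simp only [highEntry] at this
  exact Fin.ext (by omega)

end entries

/-- The positions of the entries of a filling with smallest entries at `p` and largest entries at
`q`, moved down by `d`. -/
def gluePos {n m : ℕ} (d : ℕ) (p : Fin m → ℕ × ℕ) (q : Fin (n - m) → ℕ × ℕ) (a : Fin n) :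
    ℕ × ℕ :=
  if h : a.val < m then p ⟨a.val, h⟩
  else ((q ⟨a.val - m, by omega⟩).1 + d, (q ⟨a.val - m, by omega⟩).2)

section gluePos

variable {n m : ℕ} (hm : m ≤ n) (d : ℕ) (p : Fin m → ℕ × ℕ) (q : Fin (n - m) → ℕ × ℕ)

@[simp] theorem gluePos_lowEntry (i : Fin m) : gluePos d p q (lowEntry hm i) = p i := by
  simp [gluePos, lowEntry]

@[simp] theorem gluePos_highEntry (i : Fin (n - m)) :
    gluePos d p q (highEntry hm i) = ((q i).1 + d, (q i).2) := by
  simp [gluePos, highEntry]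

end gluePos

section glue

variable {n m : ℕ} {α : Composition n} {β : Composition (n - m)}

theorem mem_inner_shift {x : ℕ × ℕ} :
    (x.1 + (α.length - β.length), x.2) ∈ inner α β ↔ x ∈ diagram β := by
  have : α.length - β.length ≤ x.1 + (α.length - β.length) := by omega
  simp only [inner, Set.mem_ofPred_eq, this, true_and, Nat.add_sub_cancel]

theorem exists_shift_of_mem_inner {x : ℕ × ℕ} (h : x ∈ inner α β) :
    ∃ y ∈ diagram β, x = (y.1 + (α.length - β.length), y.2) :=
  ⟨_, h.2, Prod.ext (by simp only; have := h.1; omega) rfl⟩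

theorem inner_subset_diagram (h : FitsIn β.blocks α.blocks) {x : ℕ × ℕ} (hx : x ∈ inner α β) :
    x ∈ diagram α := mem_diagram_of_mem_bottomCells h hx

/-- The rows of `β` are consecutive, reach the bottom of `α` and are nonempty. This keeps the first
column increasing after gluing: no small entry can sit there below a large one. -/
theorem mem_inner_of_col_zero {x y : ℕ × ℕ} (hx : x ∈ inner α β) (hy : y ∈ diagram α)
    (h : x.1 < y.1) (h0 : y.2 = 0) : y ∈ inner α β := by
  have h1 := hx.1
  refine ⟨by omega, ?_⟩
  have hlen : y.1 < α.blocks.length := lt_length_of_lt_getD hy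
  have hlen' : x.1 - (α.length - β.length) < β.blocks.length := lt_length_of_lt_getD hx.2
  simp only [diagram, Set.mem_ofPred_eq, h0]
  apply getD_pos (fun i hi => β.blocks_pos hi)
  simp only [Composition.length] at *
  omega

/-- The filling glued from a skew tableau of shape `α // β` and a tableau of shape `β` is a tableau
of shape `α`. -/
theorem IsTableau.glue (hm : m ≤ n) (hβ : FitsIn β.blocks α.blocks) {p : Fin m → ℕ × ℕ}
    {q : Fin (n - m) → ℕ × ℕ} (hp : IsTableau α β p) (hq : IsTableau β emptyComp q) :
    IsTableau α emptyComp (gluePos (α.length - β.length) p q) := by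
  have hpm : ∀ i, p i ∈ diagram α ∧ p i ∉ inner α β := fun i => (hp.mem_iff _).mpr ⟨i, rfl⟩
  have hqm : ∀ x, x ∈ diagram β ↔ ∃ a, q a = x := fun x => by
    rw [← hq.mem_iff, skewCells_emptyComp]
  have hqm' : ∀ i, ((q i).1 + (α.length - β.length), (q i).2) ∈ inner α β := fun i =>
    mem_inner_shift.mpr ((hqm _).mpr ⟨i, rfl⟩)
  refine ⟨fun a b h => ?_, fun x => ?_, fun a b h h' => ?_, fun a b h h' h'' => ?_,
    fun i j l b hij hil hb h => ?_⟩
  · obtain ⟨i, rfl⟩ | ⟨i, rfl⟩ := eq_lowEntry_or_eq_highEntry hm a <;>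
    obtain ⟨j, rfl⟩ | ⟨j, rfl⟩ := eq_lowEntry_or_eq_highEntry hm b <;>
    simp only [gluePos_lowEntry, gluePos_highEntry] at h
    · rw [hp.injective h]
    · exact absurd (h ▸ hqm' j) (hpm i).2
    · exact absurd (h ▸ hqm' i) (hpm j).2
    · simp only [Prod.mk.injEq, Nat.add_right_cancel_iff] at h
      rw [hq.injective (Prod.ext h.1 h.2)]
  · rw [skewCells_emptyComp]
    constructor
    · intro hx
      by_cases hin : x ∈ inner α β
      · obtain ⟨y, hy, rfl⟩ := exists_shift_of_mem_inner hin
        obtain ⟨a, rfl⟩ := (hqm y).mp hy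
        exact ⟨highEntry hm a, by simp⟩
      · obtain ⟨a, rfl⟩ := (hp.mem_iff x).mp ⟨hx, hin⟩
        exact ⟨lowEntry hm a, by simp⟩
    · rintro ⟨a, rfl⟩
      obtain ⟨i, rfl⟩ | ⟨i, rfl⟩ := eq_lowEntry_or_eq_highEntry hm a
      · simpa using (hpm i).1
      · simpa using inner_subset_diagram hβ (hqm' i)
  · obtain ⟨i, rfl⟩ | ⟨i, rfl⟩ := eq_lowEntry_or_eq_highEntry hm a <;>
    obtain ⟨j, rfl⟩ | ⟨j, rfl⟩ := eq_lowEntry_or_eq_highEntry hm b <;>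
    simp only [gluePos_lowEntry, gluePos_highEntry, lowEntry_lt_lowEntry, lowEntry_lt_highEntry,
      highEntry_lt_highEntry, Nat.add_right_cancel_iff] at h h' ⊢
    · exact hp.row i j h h'
    -- A small entry left of a large one in the same row would lie in `β`, whose rows are
    -- left-justified.
    · refine absurd ?_ (hpm i).2
      have hj := hqm' j
      rw [← h] at hj
      exact ⟨hj.1, lt_trans h' hj.2⟩
    · exact hq.row i j h h'
  · obtain ⟨i, rfl⟩ | ⟨i, rfl⟩ := eq_lowEntry_or_eq_highEntry hm a <;>
    obtain ⟨j, rfl⟩ | ⟨j, rfl⟩ := eq_lowEntry_or_eq_highEntry hm b <;>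
    simp only [gluePos_lowEntry, gluePos_highEntry, lowEntry_lt_lowEntry, lowEntry_lt_highEntry,
      highEntry_lt_highEntry, Nat.add_lt_add_iff_right] at h h' h'' ⊢
    · exact hp.col i j h h' h''
    · exact absurd (mem_inner_of_col_zero (hqm' i) (hpm j).1 h'' h') (hpm j).2
    · exact hq.col i j h h' h''
  · simp only [inner_emptyComp, Set.mem_empty_iff_false, false_or] at h ⊢
    obtain ⟨a, ha, hba⟩ := h
    obtain ⟨b, rfl⟩ | ⟨b, rfl⟩ := eq_lowEntry_or_eq_highEntry hm b
    · rw [gluePos_lowEntry] at hb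
      -- With `b` small, a large entry in the glued tableau plays the role of `∞` in the skew one,
      -- both in the premise and in the conclusion of the triple condition.
      obtain ⟨h1, h2⟩ := hp.triple i j l b hij hil hb (by
        obtain ⟨a, rfl⟩ | ⟨a, rfl⟩ := eq_lowEntry_or_eq_highEntry hm a
        · exact Or.inr ⟨a, by simpa using ha, by simpa using hba⟩
        · rw [gluePos_highEntry] at ha
          exact Or.inl (ha ▸ hqm' a))
      refine ⟨h1, ?_⟩
      rcases h2 with h2 | ⟨c, hc, hbc⟩
      · obtain ⟨y, hy, hxy⟩ := exists_shift_of_mem_inner h2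
        obtain ⟨c, rfl⟩ := (hqm y).mp hy
        exact ⟨highEntry hm c, by simp [hxy], by simp⟩
      · exact ⟨lowEntry hm c, by simp [hc], by simpa using hbc⟩
    -- With `b` large, the entry `a > b` is large too, so the condition is the one for `β` with rows
    -- shifted.
    · obtain ⟨a, rfl⟩ | ⟨a, rfl⟩ := eq_lowEntry_or_eq_highEntry hm a
      · simp at hba
      · rw [highEntry_lt_highEntry] at hba
        simp only [gluePos_highEntry, Prod.mk.injEq] at ha hb
        obtain ⟨h1, h2⟩ := hq.triple (q a).1 (q b).1 l b (by omega)
          ((hqm _).mpr ⟨a, Prod.ext rfl ha.2⟩) (Prod.ext rfl hb.2)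
          (Or.inr ⟨a, Prod.ext rfl ha.2, hba⟩)
        simp only [inner_emptyComp, Set.mem_empty_iff_false, false_or] at h2
        obtain ⟨c, hc, hbc⟩ := h2
        have hc' : gluePos (α.length - β.length) p q (highEntry hm c) = (i, l + 1) := by
          simp [hc, ha.1]
        refine ⟨?_, highEntry hm c, hc', by simpa using hbc⟩
        rw [← hc', gluePos_highEntry]
        exact inner_subset_diagram hβ (hqm' c)

/-- By assumption the cells of `β` hold exactly the large entries. These exceed all small ones, so
replacing them by `∞` changes no comparison with a small entry. -/
theorem IsTableau.restrict_low (hm : m ≤ n) {p : Fin n → ℕ × ℕ} (hp : IsTableau α emptyComp p)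
    (h : ∀ a, p a ∈ inner α β ↔ m ≤ a.val) : IsTableau α β (fun i => p (lowEntry hm i)) := by
  have hmem : ∀ x, x ∈ diagram α ↔ ∃ a, p a = x := fun x => by
    rw [← hp.mem_iff, skewCells_emptyComp]
  have hlow : ∀ i, p (lowEntry hm i) ∉ inner α β := fun i => by
    rw [h]; simp [lowEntry]
  have hhigh : ∀ i, p (highEntry hm i) ∈ inner α β := fun i => by
    rw [h]; simp [highEntry]
  refine ⟨fun a b hab => lowEntry_injective hm (hp.injective hab), fun x => ?_,
    fun a b => hp.row _ _, fun a b => hp.col _ _, fun i j l b hij hil hb hc => ?_⟩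
  · constructor
    · rintro ⟨hx, hx'⟩
      obtain ⟨a, rfl⟩ := (hmem x).mp hx
      obtain ⟨i, rfl⟩ | ⟨i, rfl⟩ := eq_lowEntry_or_eq_highEntry hm a
      · exact ⟨i, rfl⟩
      · exact absurd (hhigh i) hx'
    · rintro ⟨i, rfl⟩
      exact ⟨(hmem _).mpr ⟨_, rfl⟩, hlow i⟩
  · obtain ⟨h1, h2⟩ := hp.triple i j l _ hij hil hb (by
      right
      rcases hc with hc | ⟨a, ha, hba⟩
      · obtain ⟨a, ha⟩ := (hmem _).mp hil
        obtain ⟨a, rfl⟩ | ⟨a, rfl⟩ := eq_lowEntry_or_eq_highEntry hm a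
        · exact absurd (ha ▸ hc) (hlow a)
        · exact ⟨_, ha, by simp⟩
      · exact ⟨_, ha, hba⟩)
    simp only [inner_emptyComp, Set.mem_empty_iff_false, false_or] at h2
    obtain ⟨c, hc, hbc⟩ := h2
    refine ⟨h1, ?_⟩
    obtain ⟨c, rfl⟩ | ⟨c, rfl⟩ := eq_lowEntry_or_eq_highEntry hm c
    · exact Or.inr ⟨c, hc, hbc⟩
    · exact Or.inl (hc ▸ hhigh c)

/-- The triple condition of `α` yields a cell whose entry exceeds a large entry. That entry is
itself large, so the cell lies in `β`, as the triple condition of `β` demands. -/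
theorem IsTableau.restrict_high (hm : m ≤ n) (hβ : FitsIn β.blocks α.blocks)
    {p : Fin n → ℕ × ℕ} (hp : IsTableau α emptyComp p)
    (h : ∀ a, p a ∈ inner α β ↔ m ≤ a.val) {q : Fin (n - m) → ℕ × ℕ}
    (hq : ∀ i, p (highEntry hm i) = ((q i).1 + (α.length - β.length), (q i).2)) :
    IsTableau β emptyComp q := by
  have hmem : ∀ x, x ∈ diagram α ↔ ∃ a, p a = x := fun x => by
    rw [← hp.mem_iff, skewCells_emptyComp]
  have hlow : ∀ i, p (lowEntry hm i) ∉ inner α β := fun i => by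
    rw [h]; simp [lowEntry]
  have hqm : ∀ i, q i ∈ diagram β := fun i => by
    rw [← mem_inner_shift (α := α) (m := m), ← hq, h]
    simp [highEntry]
  refine ⟨fun a b hab => highEntry_injective hm (hp.injective ?_), fun x => ?_,
    fun a b h1 h2 => ?_, fun a b h1 h2 h3 => ?_, fun i j l b hij hil hb hc => ?_⟩
  · rw [hq, hq, hab]
  · rw [skewCells_emptyComp]
    constructor
    · intro hx
      have hx' := mem_inner_shift (α := α) (m := m) |>.mpr hx
      obtain ⟨a, ha⟩ := (hmem _).mp (inner_subset_diagram hβ hx')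
      obtain ⟨i, rfl⟩ | ⟨i, rfl⟩ := eq_lowEntry_or_eq_highEntry hm a
      · exact absurd (ha ▸ hx') (hlow i)
      · rw [hq] at ha
        simp only [Prod.mk.injEq, Nat.add_right_cancel_iff] at ha
        exact ⟨i, Prod.ext ha.1 ha.2⟩
    · rintro ⟨i, rfl⟩
      exact hqm i
  · rw [← highEntry_lt_highEntry hm]
    apply hp.row <;> simpa [hq]
  · rw [← highEntry_lt_highEntry hm]
    apply hp.col <;> simpa [hq]
  · simp only [inner_emptyComp, Set.mem_empty_iff_false, false_or] at hc ⊢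
    obtain ⟨a, ha, hba⟩ := hc
    obtain ⟨-, h2⟩ := hp.triple (i + (α.length - β.length)) (j + (α.length - β.length)) l
      (highEntry hm b) (by omega) ((hmem _).mpr ⟨highEntry hm a, by rw [hq, ha]⟩)
      (by rw [hq, hb]) (Or.inr ⟨highEntry hm a, by rw [hq, ha], by simpa using hba⟩)
    simp only [inner_emptyComp, Set.mem_empty_iff_false, false_or] at h2
    obtain ⟨c, hc, hbc⟩ := h2
    obtain ⟨c, rfl⟩ | ⟨c, rfl⟩ := eq_lowEntry_or_eq_highEntry hm c
    · simp at hbc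
    · rw [hq] at hc
      simp only [Prod.mk.injEq, Nat.add_right_cancel_iff] at hc
      have hc' : q c = (i, l + 1) := Prod.ext hc.1 hc.2
      exact ⟨hc' ▸ hqm c, c, hc', by simpa using hbc⟩

end glue

/-! ### The shape of the largest entries -/

/-- Rows are anchored at the bottom, so prefixing a part leaves the other cells in place. Together
with `mem_bottomCells_add_one` this shows that each covering adds a single cell. The bound `r.length
< L` leaves room for the new row. -/
theorem mem_bottomCells_one_cons {L : ℕ} {r : List ℕ} (h : r.length < L) (x : ℕ × ℕ) :
    x ∈ bottomCells L (1 :: r) ↔ x = (L - (1 :: r).length, 0) ∨ x ∈ bottomCells L r := by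
  obtain ⟨i, c⟩ := x
  simp only [bottomCells, Set.mem_ofPred_eq, List.length_cons, Prod.mk.injEq]
  rcases lt_trichotomy i (L - (r.length + 1)) with hi | rfl | hi
  · constructor <;> omega
  · have : ¬ L - r.length ≤ L - (r.length + 1) := by omega
    simp [this]
  · obtain ⟨d, hd⟩ : ∃ d, i - (L - (r.length + 1)) = d + 1 :=
      ⟨i - (L - (r.length + 1)) - 1, by omega⟩
    have hd' : i - (L - r.length) = d := by omega
    rw [hd, hd', List.getD_cons_succ]
    constructor
    · rintro ⟨-, h2⟩; exact Or.inr ⟨by omega, h2⟩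
    · rintro (h2 | ⟨-, h2⟩)
      · omega
      · exact ⟨by omega, h2⟩

theorem mem_bottomCells_add_one {L k : ℕ} {l r : List ℕ} (x : ℕ × ℕ) :
    x ∈ bottomCells L (l ++ (k + 1) :: r) ↔
      x = (L - (l ++ (k + 1) :: r).length + l.length, k) ∨ x ∈ bottomCells L (l ++ k :: r) := by
  obtain ⟨i, c⟩ := x
  simp only [bottomCells, Set.mem_ofPred_eq, List.length_append, List.length_cons, Prod.mk.injEq]
  generalize L - (l.length + (r.length + 1)) = e
  by_cases hi : e ≤ i
  · obtain ⟨d, rfl⟩ := Nat.exists_eq_add_of_le hi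
    simp only [Nat.add_sub_cancel_left, hi, true_and, Nat.add_left_cancel_iff]
    rcases lt_trichotomy d l.length with h | h | h
    · rw [List.getD_append _ _ _ _ h, List.getD_append _ _ _ _ h]
      omega
    · subst h
      simp
      omega
    · rw [List.getD_append_right _ _ _ _ h.le, List.getD_append_right _ _ _ _ h.le]
      obtain ⟨f, hf⟩ : ∃ f, d - l.length = f + 1 := ⟨d - l.length - 1, by omega⟩
      simp only [hf, List.getD_cons_succ]
      omega
  · omega

/-- The cells of a tableau of shape `α` with the `n - m` largest entries form a composition below
`α`. -/
theorem IsTableau.exists_blocks {n : ℕ} {α : Composition n} {p : Fin n → ℕ × ℕ}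
    (hp : IsTableau α emptyComp p) (m : ℕ) (hm : m ≤ n) :
    ∃ b : List ℕ, Relation.ReflTransGen Covers b α.blocks ∧ (∀ i ∈ b, 0 < i) ∧ b.sum + m = n ∧
      ∀ a, p a ∈ bottomCells α.length b ↔ m ≤ a.val := by
  have hmem : ∀ x, x ∈ diagram α ↔ ∃ a, p a = x := fun x => by
    rw [← hp.mem_iff, skewCells_emptyComp]
  -- The list `b` is the shape of the entries that are at least `m`; each step removes the cell of
  -- the entry `m`, the smallest one left.
  induction m with
  | zero =>
    refine ⟨α.blocks, .refl, fun i hi => α.blocks_pos hi, by simp, fun a => ?_⟩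
    have h := (hmem _).mpr ⟨a, rfl⟩
    simpa [bottomCells, Composition.length, diagram] using h
  | succ m ih =>
    obtain ⟨b, hle, hpos, hsum, hb⟩ := ih (by omega)
    have hfit := FitsIn.of_reflTransGen hle
    have hcell : ∀ x ∈ bottomCells α.length b, ∃ a, p a = x ∧ m ≤ a.val := fun x hx => by
      obtain ⟨a, rfl⟩ := (hmem x).mp (mem_diagram_of_mem_bottomCells hfit hx)
      exact ⟨a, rfl, (hb a).mp hx⟩
    have ha₀ : p ⟨m, hm⟩ ∈ bottomCells α.length b := (hb _).mpr le_rfl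
    obtain ⟨⟨j, k⟩, hjk⟩ : ∃ x, x = p ⟨m, hm⟩ := ⟨_, rfl⟩
    rw [← hjk] at ha₀
    obtain ⟨hj, hk⟩ := ha₀
    simp only at hj hk
    obtain ⟨d, rfl⟩ := Nat.exists_eq_add_of_le hj
    rw [Nat.add_sub_cancel_left] at hk
    have hlen := lt_length_of_lt_getD hk
    obtain ⟨l, v, r, hbl, hd⟩ : ∃ l v r, b = l ++ v :: r ∧ l.length = d :=
      ⟨b.take d, b[d], b.drop (d + 1), by simp, by simp; omega⟩
    have hbL : b.length ≤ α.length := hfit.1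
    -- The entry `m` ends its row: a cell of `b` to its right would hold an entry at least `m`,
    -- whereas rows decrease.
    have hv : v = k + 1 := by
      have hbv : b.getD d 0 = v := by
        rw [hbl, List.getD_append_right _ _ _ _ hd.le, hd]; simp
      by_contra hne
      obtain ⟨a, ha, hma⟩ := hcell (α.length - b.length + d, k + 1)
        ⟨by simp, by simp only [Nat.add_sub_cancel_left]; omega⟩
      have := hp.row ⟨m, hm⟩ a (by rw [ha, ← hjk]) (by rw [ha, ← hjk]; simp)
      simp only [Fin.lt_def] at this
      omega
    subst hv
    -- Both cases below now reduce to finding `c` covered by `b` whose cells are those of `b` except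
    -- the cell of `m`.
    have hstep : ∀ c : List ℕ, Covers c b → (∀ i ∈ c, 0 < i) → c.sum + 1 = b.sum →
        (∀ x, x ∈ bottomCells α.length b ↔ x = p ⟨m, hm⟩ ∨ x ∈ bottomCells α.length c) →
        p ⟨m, hm⟩ ∉ bottomCells α.length c →
        ∃ b : List ℕ, Relation.ReflTransGen Covers b α.blocks ∧ (∀ i ∈ b, 0 < i) ∧
          b.sum + (m + 1) = n ∧ ∀ a, p a ∈ bottomCells α.length b ↔ m + 1 ≤ a.val := by
      intro c hc hcpos hcsum hcb hcn
      refine ⟨c, .head hc hle, hcpos, by omega, fun a => ?_⟩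
      have h1 := (hcb (p a)).symm.trans (hb a)
      by_cases ham : a = ⟨m, hm⟩
      · subst ham
        simpa using hcn
      · have h2 : p a ≠ p ⟨m, hm⟩ := fun h => ham (hp.injective h)
        have h3 : a.val ≠ m := fun h => ham (Fin.ext h)
        simp only [h2, false_or] at h1
        rw [h1]
        omega
    rcases Nat.eq_zero_or_pos k with rfl | hkpos
    -- A row of `b` above would have in the first column an entry at least `m`, whereas that column
    -- increases downwards.
    · have hd0 : d = 0 := by
        by_contra hne
        obtain ⟨a, ha, hma⟩ := hcell (α.length - b.length + (d - 1), 0) ⟨by simp, by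
          simp only [Nat.add_sub_cancel_left]
          exact getD_pos hpos (by omega)⟩
        have := hp.col a ⟨m, hm⟩ (by rw [ha]) (by rw [← hjk])
          (by rw [ha, ← hjk]; simp only; omega)
        simp only [Fin.lt_def] at this
        omega
      obtain rfl : l = [] := List.eq_nil_of_length_eq_zero (hd.trans hd0)
      simp only [List.nil_append, Nat.zero_add] at hbl
      subst hbl
      have hrL : r.length < α.length := by simpa using hbL
      apply hstep r (.prefix_one r) (fun i hi => hpos i (by simp [hi])) (by simp [add_comm])
      · rw [← hjk, hd0]
        exact mem_bottomCells_one_cons hrL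
      · rw [← hjk]
        rintro ⟨h, -⟩
        simp only [List.length_cons] at h
        omega
    -- Suppose a higher row `e` of `b` has length exactly `k`. Its last cell, in column `k - 1`,
    -- holds an entry larger than `m`, and `m` sits lower in column `k`. The triple condition then
    -- puts an entry larger than `m` in row `e` and column `k`. That cell would belong to `b`,
    -- beyond the end of its row.
    · have hkl : k ∉ l := by
        intro hk
        obtain ⟨e, he, rfl⟩ := List.getElem_of_mem hk
        have hbe : b.getD e 0 = l[e] := by
          rw [hbl, List.getD_append _ _ _ _ he, List.getD_eq_getElem _ _ he]
        obtain ⟨a, ha, hma⟩ := hcell (α.length - b.length + e, l[e] - 1)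
          ⟨by simp, by simp only [Nat.add_sub_cancel_left]; omega⟩
        have hane : a ≠ ⟨m, hm⟩ := by
          rintro rfl
          rw [ha, Prod.mk.injEq] at hjk
          omega
        have hane' : a.val ≠ m := fun h => hane (Fin.ext h)
        obtain ⟨-, h2⟩ := hp.triple (α.length - b.length + e) (α.length - b.length + d)
          (l[e] - 1) ⟨m, hm⟩ (by omega) ((hmem _).mpr ⟨a, ha⟩)
          (by rw [← hjk, Nat.sub_add_cancel hkpos])
          (Or.inr ⟨a, ha, by simp only [Fin.lt_def]; omega⟩)
        simp only [inner_emptyComp, Set.mem_empty_iff_false, false_or] at h2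
        obtain ⟨c, hc, hmc⟩ := h2
        have hcb := (hb c).mpr (le_of_lt hmc)
        rw [hc] at hcb
        have := hcb.2
        simp only [Nat.add_sub_cancel_left] at this
        omega
      subst hbl
      apply hstep (l ++ k :: r) (.add_one l r k hkl)
      · intro i hi
        simp only [List.mem_append, List.mem_cons] at hi
        rcases hi with hi | rfl | hi
        · exact hpos i (by simp [hi])
        · exact hkpos
        · exact hpos i (by simp [hi])
      · simp only [List.sum_append, List.sum_cons]
        omega
      · rw [← hjk, ← hd]
        exact mem_bottomCells_add_one
      · rw [← hjk]
        rintro ⟨-, h⟩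
        simp only [List.length_append, List.length_cons, Nat.add_sub_cancel_left] at h
        rw [List.getD_append_right _ _ _ _ hd.le, hd] at h
        simp at h

/-! ### The bijection between tableaux and pairs of tableaux -/

section glueTableau

variable {n m : ℕ} (hm : m ≤ n) {α : Composition n} {β : Composition (n - m)}

theorem exists_glueTableau (hm : m ≤ n) (hβ : CompLE β α) (σ : SRCT α β m)
    (τ : SRCT β emptyComp (n - m)) :
    ∃ ρ : SRCT α emptyComp n, ρ.pos = gluePos (α.length - β.length) σ.pos τ.pos :=
  (σ.isTableau_pos.glue hm hβ.fitsIn τ.isTableau_pos).exists_pos_eq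

/-- The tableau of shape `α` with smallest entries `σ` and largest entries `τ`. -/
def glueTableau (hβ : CompLE β α) (σ : SRCT α β m) (τ : SRCT β emptyComp (n - m)) :
    SRCT α emptyComp n := (exists_glueTableau hm hβ σ τ).choose

variable (hβ : CompLE β α) (σ : SRCT α β m) (τ : SRCT β emptyComp (n - m))

@[simp] theorem glueTableau_pos_lowEntry (i : Fin m) :
    (glueTableau hm hβ σ τ).pos (lowEntry hm i) = σ.pos i := by
  rw [glueTableau, (exists_glueTableau hm hβ σ τ).choose_spec, gluePos_lowEntry]

@[simp] theorem glueTableau_pos_highEntry (i : Fin (n - m)) :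
    (glueTableau hm hβ σ τ).pos (highEntry hm i) =
      ((τ.pos i).1 + (α.length - β.length), (τ.pos i).2) := by
  rw [glueTableau, (exists_glueTableau hm hβ σ τ).choose_spec, gluePos_highEntry]

theorem eq_glueTableau {ρ : SRCT α emptyComp n} (h₁ : ∀ i, ρ.pos (lowEntry hm i) = σ.pos i)
    (h₂ : ∀ i, ρ.pos (highEntry hm i) = ((τ.pos i).1 + (α.length - β.length), (τ.pos i).2)) :
    ρ = glueTableau hm hβ σ τ := by
  apply SRCT.ext_pos
  intro a
  obtain ⟨i, rfl⟩ | ⟨i, rfl⟩ := eq_lowEntry_or_eq_highEntry hm a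
  · rw [h₁, glueTableau_pos_lowEntry]
  · rw [h₂, glueTableau_pos_highEntry]

/-- Recovers the region of `β` from the glued tableau alone, which makes gluing injective across
different `β`. -/
theorem mem_inner_iff_glueTableau (x : ℕ × ℕ) :
    x ∈ inner α β ↔ ∃ i, (glueTableau hm hβ σ τ).pos (highEntry hm i) = x := by
  constructor
  · intro hx
    obtain ⟨y, hy, rfl⟩ := exists_shift_of_mem_inner hx
    rw [← skewCells_emptyComp, τ.isTableau_pos.mem_iff] at hy
    obtain ⟨i, rfl⟩ := hy
    exact ⟨i, by simp⟩
  · rintro ⟨i, rfl⟩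
    rw [glueTableau_pos_highEntry, mem_inner_shift, ← skewCells_emptyComp]
    exact τ.pos_mem i

end glueTableau

section glueEquiv

variable {n m : ℕ} (hm : m ≤ n) (α : Composition n)

/-- Triples of a composition `β` of `n - m` below `α`, a skew tableau of shape `α // β`, and a
tableau of shape `β`. -/
abbrev TableauPair (m : ℕ) : Type :=
  Σ β : {β : Composition (n - m) // CompLE β α}, SRCT α β.1 m × SRCT β.1 emptyComp (n - m)

/-- Gluing, as a map on all pairs. -/
def gluePair (x : TableauPair α m) : SRCT α emptyComp n := glueTableau hm x.1.2 x.2.1 x.2.2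

theorem gluePair_injective : Function.Injective (gluePair hm α) := by
  rintro ⟨⟨β, hβ⟩, σ, τ⟩ ⟨⟨β', hβ'⟩, σ', τ'⟩ h
  simp only [gluePair] at h
  have hin : inner α β = inner α β' := by
    ext x
    rw [mem_inner_iff_glueTableau hm hβ σ τ, h, ← mem_inner_iff_glueTableau hm hβ' σ' τ']
  have hb : β = β' := Composition.ext
    (bottomCells_injective hβ.fitsIn.1 hβ'.fitsIn.1 (fun i hi => β.blocks_pos hi)
      (fun i hi => β'.blocks_pos hi) hin)
  subst hb
  have hσ : σ = σ' := SRCT.ext_pos fun i => by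
    rw [← glueTableau_pos_lowEntry hm hβ σ τ, h, glueTableau_pos_lowEntry]
  have hτ : τ = τ' := SRCT.ext_pos fun i => by
    have := glueTableau_pos_highEntry hm hβ σ τ i
    rw [h, glueTableau_pos_highEntry] at this
    simp only [Prod.mk.injEq, Nat.add_right_cancel_iff] at this
    exact Prod.ext this.1.symm this.2.symm
  rw [hσ, hτ]

theorem gluePair_surjective : Function.Surjective (gluePair hm α) := by
  intro ρ
  obtain ⟨b, hle, hpos, hsum, hb⟩ := ρ.isTableau_pos.exists_blocks m hm
  let β : Composition (n - m) := ⟨b, fun hi => hpos _ hi, by omega⟩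
  have hβ : CompLE β α := hle
  -- By definition `inner α β` is `bottomCells α.length b`.
  have hin : ∀ a, ρ.pos a ∈ inner α β ↔ m ≤ a.val := hb
  obtain ⟨σ, hσ⟩ := (ρ.isTableau_pos.restrict_low hm hin).exists_pos_eq
  have hex : ∀ i, ∃ y : ℕ × ℕ, ρ.pos (highEntry hm i) =
      (y.1 + (α.length - β.length), y.2) := fun i => by
    obtain ⟨y, -, hy⟩ := exists_shift_of_mem_inner
      ((hin (highEntry hm i)).mpr (by simp [highEntry]))
    exact ⟨y, hy⟩
  choose q hq using hex
  obtain ⟨τ, hτ⟩ := (ρ.isTableau_pos.restrict_high hm hβ.fitsIn hin hq).exists_pos_eq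
  refine ⟨⟨⟨β, hβ⟩, σ, τ⟩, (eq_glueTableau hm hβ σ τ (fun i => ?_) fun i => ?_).symm⟩
  · rw [hσ]
  · rw [hq, hτ]

/-- Tableaux of shape `α` correspond to pairs of tableaux. -/
def glueEquiv : TableauPair α m ≃ SRCT α emptyComp n :=
  Equiv.ofBijective (gluePair hm α) ⟨gluePair_injective hm α, gluePair_surjective hm α⟩

end glueEquiv

/-! ### Compatibility with the operators -/

namespace SRCT

variable {n k N : ℕ} {α : Composition n} {β : Composition k}

theorem piVal_attacking {i : Fin (N - 1)} {τ : SRCT α β N}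
    (h : (τ.pos (lo i)).2 = (τ.pos (hi i)).2 ∨
      ((τ.pos (hi i)).2 = (τ.pos (lo i)).2 + 1 ∧ (τ.pos (lo i)).1 < (τ.pos (hi i)).1)) :
    piVal i τ = 0 := by
  have hd : τ.IsDescent i := by unfold IsDescent; omega
  have ha : τ.Attacking i := h
  simp [piVal, hd, ha]

/-- A tableau is determined by its positions, so any `τ'` with the two positions exchanged is the
flip of `τ`; in applications `τ'` is a glued tableau. -/
theorem piVal_flip {i : Fin (N - 1)} {τ τ' : SRCT α β N}
    (h : (τ.pos (lo i)).2 < (τ.pos (hi i)).2)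
    (h' : ¬ ((τ.pos (hi i)).2 = (τ.pos (lo i)).2 + 1 ∧ (τ.pos (lo i)).1 < (τ.pos (hi i)).1))
    (hp : ∀ a, τ'.pos a = τ.pos (Equiv.swap (lo i) (hi i) a)) :
    piVal i τ = Finsupp.single τ' 1 := by
  have hd : τ.IsDescent i := h.le
  have ha : ¬ τ.Attacking i := by
    rintro (ha | ha)
    · exact h.ne ha
    · exact h' ha
  have : τ.flip i hd ha = τ' := ext_pos fun a => by rw [pos_flip, hp]
  simp [piVal, hd, ha, this]

end SRCT

section equivariance

open SRCT

variable {n m : ℕ} (hm : m ≤ n) {α : Composition n} {β : Composition (n - m)}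
  (hβ : CompLE β α)

theorem lo_lowIdx (i : Fin (m - 1)) : lo (lowIdx hm i) = lowEntry hm (lo i) := rfl

theorem hi_lowIdx (i : Fin (m - 1)) : hi (lowIdx hm i) = lowEntry hm (hi i) := rfl

theorem lo_highIdx (i : Fin (n - m - 1)) : lo (highIdx hm i) = highEntry hm (lo i) := rfl

theorem hi_highIdx (i : Fin (n - m - 1)) : hi (highIdx hm i) = highEntry hm (hi i) := rfl

theorem lowEntry_ne_highEntry (i : Fin m) (j : Fin (n - m)) :
    lowEntry hm i ≠ highEntry hm j := (lowEntry_lt_highEntry hm i j).ne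

/-- The case distinction in `piVal` depends only on the cells of the two entries concerned. Both are
small and keep their cells under gluing, and exchanging them does not touch the large entries. -/
theorem piVal_lowIdx_glueTableau (σ : SRCT α β m) (τ : SRCT β emptyComp (n - m))
    (i : Fin (m - 1)) :
    piVal (lowIdx hm i) (glueTableau hm hβ σ τ) =
      Finsupp.mapDomain (fun σ => glueTableau hm hβ σ τ) (piVal i σ) := by
  rcases piVal_cases i σ with ⟨h, e⟩ | ⟨h, e⟩ | ⟨h, h', σ', hp, e⟩
  · rw [e, Finsupp.mapDomain_single]
    apply piVal_fix
    simpa only [lo_lowIdx, hi_lowIdx, glueTableau_pos_lowEntry]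
  · rw [e, Finsupp.mapDomain_zero]
    apply piVal_attacking
    simpa only [lo_lowIdx, hi_lowIdx, glueTableau_pos_lowEntry]
  · rw [e, Finsupp.mapDomain_single]
    apply piVal_flip <;>
      simp only [lo_lowIdx, hi_lowIdx, glueTableau_pos_lowEntry]
    · exact h
    · exact h'
    · intro a
      obtain ⟨j, rfl⟩ | ⟨j, rfl⟩ := eq_lowEntry_or_eq_highEntry hm a
      · rw [← (lowEntry_injective hm).map_swap, glueTableau_pos_lowEntry,
          glueTableau_pos_lowEntry, hp]
      · rw [Equiv.swap_apply_of_ne_of_ne (lowEntry_ne_highEntry hm _ _).symm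
          (lowEntry_ne_highEntry hm _ _).symm, glueTableau_pos_highEntry,
          glueTableau_pos_highEntry]

/-- As for small entries, except that both cells move down by the same number of rows; this
preserves columns and the order of rows. -/
theorem piVal_highIdx_glueTableau (σ : SRCT α β m) (τ : SRCT β emptyComp (n - m))
    (i : Fin (n - m - 1)) :
    piVal (highIdx hm i) (glueTableau hm hβ σ τ) =
      Finsupp.mapDomain (fun τ => glueTableau hm hβ σ τ) (piVal i τ) := by
  rcases piVal_cases i τ with ⟨h, e⟩ | ⟨h, e⟩ | ⟨h, h', τ', hp, e⟩
  · rw [e, Finsupp.mapDomain_single]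
    apply piVal_fix
    simpa only [lo_highIdx, hi_highIdx, glueTableau_pos_highEntry]
  · rw [e, Finsupp.mapDomain_zero]
    apply piVal_attacking
    simpa only [lo_highIdx, hi_highIdx, glueTableau_pos_highEntry, Nat.add_lt_add_iff_right]
  · rw [e, Finsupp.mapDomain_single]
    apply piVal_flip <;>
      simp only [lo_highIdx, hi_highIdx, glueTableau_pos_highEntry, Nat.add_lt_add_iff_right]
    · exact h
    · exact h'
    · intro a
      obtain ⟨j, rfl⟩ | ⟨j, rfl⟩ := eq_lowEntry_or_eq_highEntry hm a
      · rw [Equiv.swap_apply_of_ne_of_ne (lowEntry_ne_highEntry hm _ _)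
          (lowEntry_ne_highEntry hm _ _), glueTableau_pos_lowEntry, glueTableau_pos_lowEntry]
      · rw [← (highEntry_injective hm).map_swap, glueTableau_pos_highEntry,
          glueTableau_pos_highEntry, hp]

/-! ### The linear gluing map and its action on basis tensors -/

/-- The linear map `S_{α // β} ⊗ S_β → S_α` given by gluing tableaux. -/
def glueMap : SkewModule α β m ⊗[ℂ] StraightModule β →ₗ[ℂ] StraightModule α :=
  (Finsupp.lmapDomain ℂ ℂ fun x : SRCT α β m × SRCT β emptyComp (n - m) =>
    glueTableau hm hβ x.1 x.2) ∘ₗ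
  (finsuppTensorFinsupp' ℂ (SRCT α β m) (SRCT β emptyComp (n - m))).toLinearMap

theorem glueMap_single_tmul_single (σ : SRCT α β m) (τ : SRCT β emptyComp (n - m)) (r s : ℂ) :
    glueMap hm hβ ((Finsupp.single σ r : SRCT α β m →₀ ℂ) ⊗ₜ[ℂ]
        (Finsupp.single τ s : SRCT β emptyComp (n - m) →₀ ℂ)) =
      (Finsupp.single (glueTableau hm hβ σ τ) (r * s) : SRCT α emptyComp n →₀ ℂ) := by
  unfold glueMap
  refine (congrArg (Finsupp.mapDomain _)
    (finsuppTensorFinsupp'_single_tmul_single ℂ _ _ σ τ r s)).trans ?_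
  exact Finsupp.mapDomain_single

/-- A generator sends a basis tableau to a tableau or to `0`. Allowing any vector in one factor
treats these cases together, in the `mapDomain` form of `piVal_lowIdx_glueTableau`. -/
theorem glueMap_tmul_tab (x : SRCT α β m →₀ ℂ) (τ : SRCT β emptyComp (n - m)) :
    glueMap hm hβ ((x : SkewModule α β m) ⊗ₜ[ℂ] (tab τ : StraightModule β)) =
      (Finsupp.mapDomain (fun σ => glueTableau hm hβ σ τ) x : SRCT α emptyComp n →₀ ℂ) := by
  induction x using Finsupp.induction_linear with
  | zero => exact (congrArg _ (TensorProduct.zero_tmul _ _)).trans (map_zero _)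
  | add x y hx hy =>
    rw [Finsupp.mapDomain_add, ← hx, ← hy]
    exact (congrArg _ (TensorProduct.add_tmul _ _ _)).trans (map_add _ _ _)
  | single σ r =>
    rw [Finsupp.mapDomain_single]
    exact (glueMap_single_tmul_single hm hβ σ τ r 1).trans (by rw [mul_one])

theorem glueMap_tab_tmul (σ : SRCT α β m) (x : SRCT β emptyComp (n - m) →₀ ℂ) :
    glueMap hm hβ ((tab σ : SkewModule α β m) ⊗ₜ[ℂ] (x : StraightModule β)) =
      (Finsupp.mapDomain (fun τ => glueTableau hm hβ σ τ) x : SRCT α emptyComp n →₀ ℂ) := by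
  induction x using Finsupp.induction_linear with
  | zero => exact (congrArg _ (TensorProduct.tmul_zero _ _)).trans (map_zero _)
  | add x y hx hy =>
    rw [Finsupp.mapDomain_add, ← hx, ← hy]
    exact (congrArg _ (TensorProduct.tmul_add _ _ _)).trans (map_add _ _ _)
  | single τ r =>
    rw [Finsupp.mapDomain_single]
    exact (glueMap_single_tmul_single hm hβ σ τ 1 r).trans (by rw [one_mul])

theorem glueMap_tab_tmul_tab (σ : SRCT α β m) (τ : SRCT β emptyComp (n - m)) :
    glueMap hm hβ (tab σ ⊗ₜ[ℂ] tab τ) = tab (glueTableau hm hβ σ τ) :=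
  (glueMap_single_tmul_single hm hβ σ τ 1 1).trans (by rw [mul_one]; rfl)

theorem skewModule_hom_ext {k l N : ℕ} {α : Composition k} {β : Composition l} {M : Type*}
    [AddCommGroup M] [Module ℂ M] {f g : SkewModule α β N →ₗ[ℂ] M}
    (h : ∀ τ, f (tab τ) = g (tab τ)) : f = g :=
  Finsupp.lhom_ext' (α := SRCT α β N) (M := ℂ) (φ := f) (ψ := g)
    fun τ => LinearMap.ext_ring (h τ)

theorem outer_hom_ext {M : Type*} [AddCommGroup M] [Module ℂ M]
    {f g : SkewModule α β m ⊗[ℂ] StraightModule β →ₗ[ℂ] M}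
    (h : ∀ σ τ, f (tab σ ⊗ₜ[ℂ] tab τ) = g (tab σ ⊗ₜ[ℂ] tab τ)) : f = g :=
  TensorProduct.ext (skewModule_hom_ext fun σ => skewModule_hom_ext fun τ => h σ τ)

theorem glueMap_intertwines_T_tmul_one (i : Fin (m - 1)) :
    glueMap hm hβ ∘ₗ outerRep α β β (T i ⊗ₜ[ℂ] 1) =
      skewRep α emptyComp (tensorHom hm (T i ⊗ₜ[ℂ] 1)) ∘ₗ glueMap hm hβ := by
  refine outer_hom_ext fun σ τ => ?_
  have h1 : outerRep α β β (T i ⊗ₜ[ℂ] 1) (tab σ ⊗ₜ[ℂ] tab τ) =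
      ((T i : Hecke m) • tab σ) ⊗ₜ[ℂ] ((1 : Hecke (n - m)) • tab τ) :=
    outer_smul_tmul α β β (T i) 1 (tab σ) (tab τ)
  have h2 : tensorHom hm (T i ⊗ₜ[ℂ] 1) = T (lowIdx hm i) := by
    simp [tensorHom, lowHom]
  rw [LinearMap.comp_apply, LinearMap.comp_apply, h1, h2, one_smul, glueMap_tab_tmul_tab,
    T_smul_tab, ← smul_def, T_smul_tab, piVal_lowIdx_glueTableau]
  exact glueMap_tmul_tab hm hβ _ τ

theorem glueMap_intertwines_one_tmul_T (i : Fin (n - m - 1)) :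
    glueMap hm hβ ∘ₗ outerRep α β β (1 ⊗ₜ[ℂ] T i) =
      skewRep α emptyComp (tensorHom hm (1 ⊗ₜ[ℂ] T i)) ∘ₗ glueMap hm hβ := by
  refine outer_hom_ext fun σ τ => ?_
  have h1 : outerRep α β β (1 ⊗ₜ[ℂ] T i) (tab σ ⊗ₜ[ℂ] tab τ) =
      ((1 : Hecke m) • tab σ) ⊗ₜ[ℂ] ((T i : Hecke (n - m)) • tab τ) :=
    outer_smul_tmul α β β 1 (T i) (tab σ) (tab τ)
  have h2 : tensorHom hm (1 ⊗ₜ[ℂ] T i) = T (highIdx hm i) := by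
    simp [tensorHom, highHom]
  rw [LinearMap.comp_apply, LinearMap.comp_apply, h1, h2, one_smul, glueMap_tab_tmul_tab,
    T_smul_tab, ← smul_def, T_smul_tab, piVal_highIdx_glueTableau]
  exact glueMap_tab_tmul hm hβ σ _

/-! ### From generators to the whole tensor product algebra -/

/-- Two representations of an algebra intertwined by `φ` on `a` and `b` are intertwined on
`a * b`. -/
theorem intertwines_mul {A V W : Type*} [Ring A] [Algebra ℂ A] [AddCommGroup V] [Module ℂ V]
    [AddCommGroup W] [Module ℂ W] {ρ : A →ₐ[ℂ] Module.End ℂ V} {ρ' : A →ₐ[ℂ] Module.End ℂ W}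
    {φ : V →ₗ[ℂ] W} {a b : A} (ha : φ ∘ₗ ρ a = ρ' a ∘ₗ φ) (hb : φ ∘ₗ ρ b = ρ' b ∘ₗ φ) :
    φ ∘ₗ ρ (a * b) = ρ' (a * b) ∘ₗ φ := by
  rw [map_mul, map_mul, Module.End.mul_eq_comp, Module.End.mul_eq_comp, ← LinearMap.comp_assoc,
    ha, LinearMap.comp_assoc, hb, LinearMap.comp_assoc]

theorem intertwines_algebraMap {A V W : Type*} [Ring A] [Algebra ℂ A] [AddCommGroup V]
    [Module ℂ V] [AddCommGroup W] [Module ℂ W] (ρ : A →ₐ[ℂ] Module.End ℂ V)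
    (ρ' : A →ₐ[ℂ] Module.End ℂ W) (φ : V →ₗ[ℂ] W) (r : ℂ) :
    φ ∘ₗ ρ (algebraMap ℂ A r) = ρ' (algebraMap ℂ A r) ∘ₗ φ := by
  ext v
  simp [Module.algebraMap_end_apply]

/-- Two representations of `H_n(0)` intertwined on the generators are intertwined. -/
theorem hecke_intertwines {N : ℕ} {V W : Type*} [AddCommGroup V] [Module ℂ V] [AddCommGroup W]
    [Module ℂ W] (ρ : Hecke N →ₐ[ℂ] Module.End ℂ V) (ρ' : Hecke N →ₐ[ℂ] Module.End ℂ W)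
    (φ : V →ₗ[ℂ] W) (h : ∀ i, φ ∘ₗ ρ (T i) = ρ' (T i) ∘ₗ φ) (x : Hecke N) :
    φ ∘ₗ ρ x = ρ' x ∘ₗ φ := by
  have hx : x ∈ Algebra.adjoin ℂ (Set.range (T (n := N))) := by rw [adjoin_T]; trivial
  induction hx using Algebra.adjoin_induction with
  | mem x hx => obtain ⟨i, rfl⟩ := hx; exact h i
  | algebraMap r => exact intertwines_algebraMap ρ ρ' φ r
  | add a b _ _ ha hb =>
    rw [map_add, map_add, LinearMap.comp_add, LinearMap.add_comp, ha, hb]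
  | mul a b _ _ ha hb => exact intertwines_mul ha hb

/-- Intertwining survives sums and products, and `a ⊗ b = (a ⊗ 1)(1 ⊗ b)`. So it suffices to treat
each factor separately, where only the generators need checking. -/
theorem glueMap_intertwines (x : Hecke m ⊗[ℂ] Hecke (n - m)) :
    glueMap hm hβ ∘ₗ outerRep α β β x =
      skewRep α emptyComp (tensorHom hm x) ∘ₗ glueMap hm hβ := by
  let ρ' := (skewRep (N := n) α emptyComp).comp (tensorHom hm)
  change glueMap hm hβ ∘ₗ outerRep α β β x = ρ' x ∘ₗ glueMap hm hβ
  induction x using TensorProduct.induction_on with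
  | zero => rw [map_zero, map_zero, LinearMap.comp_zero, LinearMap.zero_comp]
  | add a b ha hb =>
    rw [map_add, map_add, LinearMap.comp_add, LinearMap.add_comp, ha, hb]
  | tmul a b =>
    have hab : a ⊗ₜ[ℂ] b = (a ⊗ₜ[ℂ] 1) * (1 ⊗ₜ[ℂ] b) := by
      rw [Algebra.TensorProduct.tmul_mul_tmul, one_mul, mul_one]
    rw [hab]
    refine intertwines_mul ?_ ?_
    · exact hecke_intertwines ((outerRep α β β).comp Algebra.TensorProduct.includeLeft)
        (ρ'.comp Algebra.TensorProduct.includeLeft) (glueMap hm hβ)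
        (glueMap_intertwines_T_tmul_one hm hβ) a
    · exact hecke_intertwines ((outerRep α β β).comp Algebra.TensorProduct.includeRight)
        (ρ'.comp Algebra.TensorProduct.includeRight) (glueMap hm hβ)
        (glueMap_intertwines_one_tmul_T hm hβ) b

/-- Gluing of tableaux as a map of `H_m(0) ⊗ H_{n-m}(0)`-modules. -/
def glueHom : OuterTensor α β m β →ₗ[Hecke m ⊗[ℂ] Hecke (n - m)] Restricted α hm where
  toFun := glueMap hm hβ
  map_add' := (glueMap hm hβ).map_add
  -- The restricted action passes through the inverse of `parabolicEquiv`, whose underlying map is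
  -- `tensorHom`.
  map_smul' x v := LinearMap.congr_fun (glueMap_intertwines hm hβ x) v

end equivariance

/-! ### The isomorphism -/

section isomorphism

variable {n m : ℕ} (hm : m ≤ n) (α : Composition n)

open Classical in
/-- The linear isomorphism between the direct sum of the modules `S_{α // β} ⊗ S_β` and `S_α`
induced by the bijection on bases. -/
def glueLinearEquiv :
    (⨁ β : {β : Composition (n - m) // CompLE β α},
      SkewModule α β.1 m ⊗[ℂ] StraightModule β.1) ≃ₗ[ℂ] StraightModule α :=
  DFinsupp.mapRange.linearEquiv (fun β : {β : Composition (n - m) // CompLE β α} =>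
      finsuppTensorFinsupp' ℂ (SRCT α β.1 m) (SRCT β.1 emptyComp (n - m))) ≪≫ₗ
    (sigmaFinsuppLequivDFinsupp ℂ).symm ≪≫ₗ Finsupp.domLCongr (glueEquiv hm α)

-- Both sides are linear in `x`, and on a tensor of two tableaux both give the glued tableau.
open Classical in
theorem glueLinearEquiv_of (β : {β : Composition (n - m) // CompLE β α})
    (x : SkewModule α β.1 m ⊗[ℂ] StraightModule β.1) :
    glueLinearEquiv hm α (DirectSum.lof ℂ _ (fun β : {β : Composition (n - m) // CompLE β α} =>
      SkewModule α β.1 m ⊗[ℂ] StraightModule β.1) β x) = glueMap hm β.2 x := by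
  rw [← LinearEquiv.coe_coe, ← LinearMap.comp_apply]
  refine LinearMap.congr_fun (outer_hom_ext fun σ τ => ?_) x
  rw [glueMap_tab_tmul_tab]
  have h1 : finsuppTensorFinsupp' ℂ (SRCT α β.1 m) (SRCT β.1 emptyComp (n - m))
      (tab σ ⊗ₜ[ℂ] tab τ) = Finsupp.single (σ, τ) 1 :=
    (finsuppTensorFinsupp'_single_tmul_single ℂ _ _ σ τ 1 1).trans (by rw [mul_one])
  have h2 : DFinsupp.mapRange.linearEquiv (fun β : {β : Composition (n - m) // CompLE β α} =>
      finsuppTensorFinsupp' ℂ (SRCT α β.1 m) (SRCT β.1 emptyComp (n - m)))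
      (DFinsupp.single β (tab σ ⊗ₜ[ℂ] tab τ)) =
      sigmaFinsuppLequivDFinsupp ℂ (Finsupp.single ⟨β, σ, τ⟩ (1 : ℂ)) := by
    refine (DFinsupp.mapRange_single (hf := fun _ => map_zero _)).trans ?_
    rw [h1]
    exact (sigmaFinsuppEquivDFinsupp_single
      (⟨β, σ, τ⟩ : TableauPair α m) (1 : ℂ)).symm
  have h3 : Finsupp.domLCongr (R := ℂ) (glueEquiv hm α)
      (Finsupp.single ⟨β, σ, τ⟩ (1 : ℂ)) = tab (glueTableau hm β.2 σ τ) :=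
    Finsupp.domLCongr_single (R := ℂ) (glueEquiv hm α) ⟨β, σ, τ⟩ (1 : ℂ)
  refine Eq.trans ?_ h3
  refine congrArg (Finsupp.domLCongr (R := ℂ) (M := ℂ) (glueEquiv hm α)) ?_
  rw [← (sigmaFinsuppLequivDFinsupp ℂ).symm_apply_apply (Finsupp.single _ _)]
  exact congrArg (sigmaFinsuppLequivDFinsupp ℂ).symm h2

open Classical in
/-- Gluing of tableaux, as a map of modules on the direct sum. -/
def glueSum : (⨁ β : {β : Composition (n - m) // CompLE β α}, OuterTensor α β.1 m β.1)
    →ₗ[Hecke m ⊗[ℂ] Hecke (n - m)] Restricted α hm :=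
  DirectSum.toModule _ _ _ fun β => glueHom hm β.2

/-- Equivariance is built into `glueSum` and bijectivity into `glueLinearEquiv`; their agreement on
each summand combines the two properties. -/
theorem glueSum_eq_glueLinearEquiv
    (x : ⨁ β : {β : Composition (n - m) // CompLE β α}, OuterTensor α β.1 m β.1) :
    glueSum hm α x = toRestricted α hm (glueLinearEquiv hm α x) := by
  classical
  -- The two maps are linear over different rings, so they are compared as additive maps.
  let f : (⨁ β : {β : Composition (n - m) // CompLE β α}, OuterTensor α β.1 m β.1) →+
      Restricted α hm :=
    (toRestricted α hm).toAddMonoidHom.comp (glueLinearEquiv hm α).toLinearMap.toAddMonoidHom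
  have h : (glueSum hm α).toAddMonoidHom = f := by
    refine DirectSum.addHom_ext fun β y => ?_
    have h1 : glueSum hm α (DirectSum.lof (Hecke m ⊗[ℂ] Hecke (n - m)) _ _ β y) =
        glueHom hm β.2 y := DirectSum.toModule_lof _ _ _
    refine Eq.trans ?_ (glueLinearEquiv_of hm α β y).symm
    exact h1
  exact DFunLike.congr_fun h x

theorem glueSum_bijective : Function.Bijective (glueSum hm α) := by
  have h : ⇑(glueSum hm α) = toRestricted α hm ∘ glueLinearEquiv hm α :=
    funext (glueSum_eq_glueLinearEquiv hm α)
  rw [h]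
  exact (toRestricted α hm).bijective.comp (glueLinearEquiv hm α).bijective

end isomorphism

end

end ZeroHecke

theorem theorem9p9 (n m : ℕ) (hm : m ≤ n) (α : Composition n) :
    Nonempty (ZeroHecke.Restricted α hm ≃ₗ[ZeroHecke.Hecke m ⊗[ℂ] ZeroHecke.Hecke (n - m)]
      ⨁ β : {β : Composition (n - m) // ZeroHecke.CompLE β α},
        ZeroHecke.OuterTensor α β.1 m β.1) :=
  ⟨(LinearEquiv.ofBijective (ZeroHecke.glueSum hm α) (ZeroHecke.glueSum_bijective hm α)).symm⟩
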